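/- Let $d\ge 1$. A \emph{tile} is a nonempty compact set $t\subset\mathbb R^d$ with $t=\overline{\mathring t}$. Let $\mathbf T$ be a finite set of prototiles (tiles up to translation), each of which has connected interior. Let $X_{\mathbf T}$ be the set of all tilings, i.e. sets of translates of prototiles of $\mathbf T$ that cover $\mathbb R^d$ and have pairwise disjoint interiors. A \emph{patch} of a tiling $\mathcal T$ is a finite set $P\subset\mathcal T$ that is simply connected in the following sense: its support $\operatorname{supp}P=\bigcup_{t\in P}t$ is nonempty and connected and has no holes, that is, $\mathbb R^d\setminus\operatorname{supp}P$ has no bounded connected component. Write $B_r$ for the closed ball of radius $r$ centred at $0$. For compact $K$ let $\mathcal T[[K]]$ be the set of patches $P$ of $\mathcal T$ with $K\subset\operatorname{supp}P$, and let $\mathcal T[K]=\bigcap_{P\in\mathcal T[[K]]}P$. Let $H$ be the Hausdorff distance on nonempty bounded sets. For patches put $$H(P_0,P_1)=\max\Bigl(\max_{t_0\in P_0}\min_{t_1\in P_1}H(t_0,t_1),\ \max_{t_1\in P_1}\min_{t_0\in P_0}H(t_0,t_1)\Bigr),$$ and let $\partial_r\mathcal T=\partial B_r\cup\bigl(B_r\cap\bigcup_{t\in\mathcal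 T}\partial t\bigr)$. Define \begin{align*} d_{s1}(\mathcal T_0,\mathcal T_1)&=\inf\{1\}\cup\{r>0:\exists x\in B_r,\ P_0\in\mathcal T_0[[B_{1/r}]],\ P_1\in\mathcal T_1[[B_{1/r}]],\ P_0=P_1+x\},\\ d_{s2}(\mathcal T_0,\mathcal T_1)&=\inf\{1\}\cup\{r>0:\exists x_0,x_1\in B_r,\ (\mathcal T_0+x_0)[B_{1/r}]=(\mathcal T_1+x_1)[B_{1/r}]\},\\ d_{w1}(\mathcal T_0,\mathcal T_1)&=\inf\{1\}\cup\{r>0:\exists P_0\in\mathcal T_0[[B_{1/r}]],\ P_1\in\mathcal T_1[[B_{1/r}]],\ H(P_0,P_1)\le r\},\\ d_{w2}(\mathcal T_0,\mathcal T_1)&=\inf\{1\}\cup\{r>0:H(\partial_{1/r}\mathcal T_0,\partial_{1/r}\mathcal T_1)\le r\}. \end{align*} Let $X\subseteq X_{\mathbf T}$ be translation invariant (for example $X=X_{\mathbf T}$, or any subshift, i.e. closed translation-invariant subset of $X_{\mathbf T}$) and suppose that $X$ has finite local complexity: for every compact $K\subset\mathbb R^d$ the patches $P$ of tilings in $X$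 with $\operatorname{supp}P\subset K$ are finitely many up to translation. Then $d_{s1},d_{s2},d_{w1},d_{w2}$ are pairwise metrically equivalent on $X$: for any two of them, $\delta$ and $\delta'$, there are constants $\alpha,\beta>0$ with $\alpha\,\delta(\mathcal T_0,\mathcal T_1)\le\delta'(\mathcal T_0,\mathcal T_1)\le\beta\,\delta(\mathcal T_0,\mathcal T_1)$ for all $\mathcal T_0,\mathcal T_1\in X$. Moreover there is $c>0$ such that any two patches $P_0,P_1$ of tilings in $X$ with $H(P_0,P_1)\le c$ satisfy $P_0=P_1+x$ for some $x$ with $\|x\|=H(P_0,P_1)$, and such that $d_{s1}\le\frac1c\,d_{w1}$ on $X$. -/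

import Mathlib

open scoped Pointwise

namespace EuclTiling

/-- The Euclidean space of dimension `d`. -/
abbrev Space (d : ℕ) : Type := EuclideanSpace ℝ (Fin d)

variable {d : ℕ}

/-- A tile: a nonempty compact set which is the closure of its interior. -/
def IsTile (t : Set (Space d)) : Prop :=
  t.Nonempty ∧ IsCompact t ∧ closure (interior t) = t

/-- A tileset, given by representatives of its prototiles (tiles up to translation):
a finite set of tiles. -/
def IsTileset (𝒯 : Set (Set (Space d))) : Prop :=
  𝒯.Finite ∧ ∀ p ∈ 𝒯, IsTile p

/-- The full shift: all coverings of the space by pairwise non-overlapping translates of the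
prototiles. -/
def fullShift (𝒯 : Set (Set (Space d))) : Set (Set (Set (Space d))) :=
  {T | (∀ t ∈ T, ∃ p ∈ 𝒯, ∃ x : Space d, t = x +ᵥ p) ∧
    ⋃₀ T = Set.univ ∧
    ∀ t ∈ T, ∀ t' ∈ T, t ≠ t' → Disjoint (interior t) (interior t')}

/-- A patch of `T`: a finite set of tiles of `T` whose support is connected and has no holes,
a hole being a bounded connected component of the complement of the support. -/
def IsPatch (T P : Set (Set (Space d))) : Prop :=
  P ⊆ T ∧ P.Finite ∧ IsConnected (⋃₀ P) ∧
    ∀ y ∈ (⋃₀ P)ᶜ, ¬ Bornology.IsBounded (connectedComponentIn (⋃₀ P)ᶜ y)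

/-- The `K`-patches `T[[K]]`: the patches of `T` whose support covers `K`. -/
def coverPatches (T : Set (Set (Space d))) (K : Set (Space d)) : Set (Set (Set (Space d))) :=
  {P | IsPatch T P ∧ K ⊆ ⋃₀ P}

/-- The smallest `K`-patch `T[K]`: the intersection of all `K`-patches. -/
def minPatch (T : Set (Set (Space d))) (K : Set (Space d)) : Set (Set (Space d)) :=
  ⋂₀ coverPatches T K

/-- The closed ball of centre `0` and radius `r`. -/
abbrev cball (r : ℝ) : Set (Space d) := Metric.closedBall 0 r

/-- Hausdorff distance between patches:
`max (max_{t₀ ∈ P₀} min_{t₁ ∈ P₁} H(t₀,t₁)) (max_{t₁ ∈ P₁} min_{t₀ ∈ P₀} H(t₀,t₁))`. -/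
noncomputable def patchDist (P₀ P₁ : Set (Set (Space d))) : ℝ :=
  max (⨆ t₀ : P₀, ⨅ t₁ : P₁, Metric.hausdorffDist (t₀ : Set (Space d)) (t₁ : Set (Space d)))
    (⨆ t₁ : P₁, ⨅ t₀ : P₀, Metric.hausdorffDist (t₀ : Set (Space d)) (t₁ : Set (Space d)))

/-- The `r`-boundary of a tiling: the sphere of radius `r` together with the part of the
boundaries of the tiles that lies in the closed ball of radius `r`. -/
def rBoundary (r : ℝ) (T : Set (Set (Space d))) : Set (Space d) :=
  Metric.sphere 0 r ∪ (cball r ∩ ⋃ t ∈ T, frontier t)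

/-- The first strong distance. -/
noncomputable def ds1 (T₀ T₁ : Set (Set (Space d))) : ℝ :=
  sInf ({1} ∪ {r : ℝ | 0 < r ∧ ∃ x ∈ cball (d := d) r,
    ∃ P₀ ∈ coverPatches T₀ (cball (1 / r)), ∃ P₁ ∈ coverPatches T₁ (cball (1 / r)),
      P₀ = x +ᵥ P₁})

/-- The second strong distance. -/
noncomputable def ds2 (T₀ T₁ : Set (Set (Space d))) : ℝ :=
  sInf ({1} ∪ {r : ℝ | 0 < r ∧ ∃ x₀ ∈ cball (d := d) r, ∃ x₁ ∈ cball (d := d) r,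
    minPatch (x₀ +ᵥ T₀) (cball (1 / r)) = minPatch (x₁ +ᵥ T₁) (cball (1 / r))})

/-- The first weak distance. -/
noncomputable def dw1 (T₀ T₁ : Set (Set (Space d))) : ℝ :=
  sInf ({1} ∪ {r : ℝ | 0 < r ∧
    ∃ P₀ ∈ coverPatches T₀ (cball (1 / r)), ∃ P₁ ∈ coverPatches T₁ (cball (1 / r)),
      patchDist P₀ P₁ ≤ r})

/-- The second weak distance. -/
noncomputable def dw2 (T₀ T₁ : Set (Set (Space d))) : ℝ :=
  sInf ({1} ∪ {r : ℝ | 0 < r ∧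
    Metric.hausdorffDist (rBoundary (1 / r) T₀) (rBoundary (1 / r) T₁) ≤ r})

/-- The patches that appear in the tilings of `X`. -/
def patchesOf (X : Set (Set (Set (Space d)))) : Set (Set (Set (Space d))) :=
  {P | ∃ T ∈ X, IsPatch T P}

/-- Finite local complexity: for every compact `K`, the patches of the tilings of `X` that are
covered by `K` are finitely many up to translation. -/
def FLC (X : Set (Set (Set (Space d)))) : Prop :=
  ∀ K : Set (Space d), IsCompact K →
    ∃ F : Set (Set (Set (Space d))), F.Finite ∧
      ∀ P ∈ patchesOf X, ⋃₀ P ⊆ K → ∃ Q ∈ F, ∃ x : Space d, P = x +ᵥ Q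

/-- Metric equivalence of `δ` and `δ'` on `X`: `α δ ≤ δ' ≤ β δ` for some constants
`α, β > 0`. -/
def MetricEquivOn {A : Type} (X : Set A) (δ δ' : A → A → ℝ) : Prop :=
  ∃ α β : ℝ, 0 < α ∧ 0 < β ∧
    ∀ a ∈ X, ∀ b ∈ X, α * δ a b ≤ δ' a b ∧ δ' a b ≤ β * δ a b

end EuclTiling

open EuclTiling

/-!
The distances are compared through `ds1`. Each of them is the infimum of `1` and a set of radii, so
a comparison follows once every radius `r` for one distance gives the radius `C * r` for the other
(`sInf_le_mul_sInf`).

* `ds1` and `ds2`. The smallest patch around a ball is itself a patch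
  (`minPatch_mem_coverPatches`): it is obtained from the tiles that meet the open ball by filling
  the holes of their union. Hence two tilings share a patch that covers a ball if and only if their
  smallest patches around this ball coincide, and moving the tilings by at most `r` only costs a
  factor `2` in the radius.
* `ds1` and `dw1`. The key is rigidity (`exists_rigidity_constant`). Two tiles that are close
  enough are translates of each other, since there are finitely many prototiles, and the Hausdorff
  distance between a tile and its translate is the length of the translation. By finite local
  complexity the relative positions of two intersecting tiles form a finite set
  (`finite_displacements`), so if all tiles of a connected part of a tiling are close to tiles of
  another one, the translation vectors of intersecting tiles agree, and all of them are equal.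
* `ds1` and `dw2`. If two tilings share a patch up to a translation by at most `r`, their boundaries
  are at distance at most `r` well inside the patch, and the spheres take care of the points that
  the translation moves out of the ball. Conversely, let the boundaries be at distance at most `r`
  in the ball of radius `1 / r`, with `r` small. Every tile contains a connected skeleton that is
  nearly dense and stays away from the boundary; a skeleton avoids the boundary of the other
  tiling, so it lies in one of its tiles, and doing this in both directions pairs the tiles of the
  two tilings (`exists_hausdorffDist_le_of_rBoundary`). Rigidity gives one translation `x`, of length
  bounded by a constant. That `x` has length of order `r` follows because `x` is an almost period
  of the boundary near the origin: translating a boundary point that lies behind an inscribed ball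
  repeatedly by `x`, with errors at most `2 * r`, would lead to a boundary point inside the ball if
  `r` were much smaller than the length of `x` (`norm_mul_le_of_almost_period`).
-/

open scoped Pointwise

namespace EuclTiling

open Metric Set

variable {d : ℕ} {𝒯 : Set (Set (Space d))} {T P : Set (Set (Space d))} {t t' : Set (Space d)}
  {X : Set (Set (Set (Space d)))}

/-! ### Tiles and tilings -/

theorem IsTile.isClosed (ht : IsTile t) : IsClosed t := ht.2.1.isClosed

theorem IsTile.vadd (ht : IsTile t) (x : Space d) : IsTile (x +ᵥ t) := by
  refine ⟨ht.1.vadd_set, ht.2.1.vadd x, ?_⟩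
  rw [interior_vadd, closure_vadd, ht.2.2]

theorem isTile_of_mem (h𝒯 : IsTileset 𝒯) (hT : T ∈ fullShift 𝒯) (ht : t ∈ T) : IsTile t := by
  obtain ⟨p, hp, x, rfl⟩ := hT.1 t ht
  exact (h𝒯.2 p hp).vadd x

theorem vadd_mem_fullShift (hT : T ∈ fullShift 𝒯) (x : Space d) : x +ᵥ T ∈ fullShift 𝒯 := by
  refine ⟨?_, ?_, ?_⟩
  · rintro _ ⟨t, ht, rfl⟩
    obtain ⟨p, hp, y, rfl⟩ := hT.1 t ht
    exact ⟨p, hp, x + y, by simp [add_vadd]⟩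
  · rw [eq_univ_iff_forall]
    intro y
    have : -x + y ∈ ⋃₀ T := by rw [hT.2.1]; trivial
    obtain ⟨t, ht, hy⟩ := this
    exact ⟨x +ᵥ t, ⟨t, ht, rfl⟩, ⟨-x + y, hy, by simp⟩⟩
  · rintro _ ⟨t, ht, rfl⟩ _ ⟨t', ht', rfl⟩ hne
    simp only [interior_vadd]
    rw [disjoint_vadd_set]
    exact hT.2.2 t ht t' ht' (fun h => hne (by rw [h]))

/-- A tile of a tiling is the only one that contains a given interior point of it: another tile
containing the point would, as the closure of its interior, overlap the first one. -/
theorem eq_of_mem_interior (h𝒯 : IsTileset 𝒯) (hT : T ∈ fullShift 𝒯) (ht : t ∈ T) (ht' : t' ∈ T)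
    {z : Space d} (hz : z ∈ interior t) (hz' : z ∈ t') : t = t' := by
  by_contra hne
  rw [← (isTile_of_mem h𝒯 hT ht').2.2] at hz'
  obtain ⟨w, hw, hw'⟩ := mem_closure_iff.1 hz' _ isOpen_interior hz
  exact disjoint_left.1 (hT.2.2 t ht t' ht' hne) hw hw'

theorem exists_mem_tile (hT : T ∈ fullShift 𝒯) (y : Space d) : ∃ t ∈ T, y ∈ t := by
  have : y ∈ ⋃₀ T := by rw [hT.2.1]; trivial
  exact this

/-- A common bound for the prototiles. -/
theorem IsTileset.exists_bound (h𝒯 : IsTileset 𝒯) :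
    ∃ M : ℝ, 0 < M ∧ ∀ p ∈ 𝒯, p ⊆ closedBall 0 M := by
  have hb : Bornology.IsBounded (⋃₀ 𝒯) :=
    (Bornology.isBounded_sUnion h𝒯.1).2 fun p hp => (h𝒯.2 p hp).2.1.isBounded
  obtain ⟨M, hM⟩ := hb.subset_closedBall 0
  exact ⟨max M 1, by positivity, fun p hp => (subset_sUnion_of_mem hp).trans
    (hM.trans (closedBall_subset_closedBall (le_max_left _ _)))⟩

/-- A finite family of positive quantities has a common positive lower bound. -/
theorem exists_pos_forall_of_finite {ι : Type*} {s : Set ι} (hs : s.Finite) {Q : ι → ℝ → Prop}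
    (hmono : ∀ i a b, a ≤ b → Q i b → Q i a) (h : ∀ i ∈ s, ∃ a > 0, Q i a) :
    ∃ a > 0, ∀ i ∈ s, Q i a := by
  induction s, hs using Set.Finite.induction_on with
  | empty => exact ⟨1, one_pos, by simp⟩
  | @insert i s _ _ ih =>
    obtain ⟨a, ha, hQ⟩ := ih fun j hj => h j (mem_insert_of_mem _ hj)
    obtain ⟨b, hb, hQ'⟩ := h i (mem_insert _ _)
    refine ⟨min a b, lt_min ha hb, ?_⟩
    rintro j (rfl | hj)
    · exact hmono _ _ _ (min_le_right _ _) hQ'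
    · exact hmono _ _ _ (min_le_left _ _) (hQ j hj)

/-- A common inradius for the prototiles. -/
theorem IsTileset.exists_inradius (h𝒯 : IsTileset 𝒯) :
    ∃ ρ : ℝ, 0 < ρ ∧ ∀ p ∈ 𝒯, ∃ z, ball z ρ ⊆ p := by
  refine exists_pos_forall_of_finite h𝒯.1
    (fun p a b hab ⟨z, hz⟩ => ⟨z, (ball_subset_ball hab).trans hz⟩) fun p hp => ?_
  have hne : (interior p).Nonempty := by
    rw [← closure_nonempty_iff, (h𝒯.2 p hp).2.2]; exact (h𝒯.2 p hp).1
  obtain ⟨z, hz⟩ := hne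
  obtain ⟨a, ha, h⟩ := Metric.isOpen_iff.1 isOpen_interior z hz
  exact ⟨a, ha, z, h.trans interior_subset⟩

theorem dist_le_of_mem_tile {M : ℝ} (hM : ∀ p ∈ 𝒯, p ⊆ closedBall 0 M) (hT : T ∈ fullShift 𝒯)
    (ht : t ∈ T) {a b : Space d} (ha : a ∈ t) (hb : b ∈ t) : dist a b ≤ 2 * M := by
  obtain ⟨p, hp, x, rfl⟩ := hT.1 t ht
  obtain ⟨a, ha, rfl⟩ := ha
  obtain ⟨b, hb, rfl⟩ := hb
  have h1 := hM p hp ha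
  have h2 := hM p hp hb
  rw [mem_closedBall, dist_zero_right] at h1 h2
  simp only [vadd_eq_add, dist_eq_norm, add_sub_add_left_eq_sub]
  linarith [norm_sub_le a b]

theorem exists_ball_subset_tile {ρ : ℝ} (hρ : ∀ p ∈ 𝒯, ∃ z, ball z ρ ⊆ p)
    (hT : T ∈ fullShift 𝒯) (ht : t ∈ T) : ∃ z, ball z ρ ⊆ interior t := by
  obtain ⟨p, hp, x, rfl⟩ := hT.1 t ht
  obtain ⟨z, hz⟩ := hρ p hp
  refine ⟨x + z, interior_maximal ?_ isOpen_ball⟩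
  intro y hy
  refine ⟨-x + y, hz ?_, by simp⟩
  rw [mem_ball, dist_eq_norm] at hy ⊢
  convert hy using 2
  abel

/-- Tilings are locally finite: only finitely many tiles meet a given ball. The centres of the
balls inscribed in the tiles are separated by the inradius. -/
theorem finite_tiles_inter_closedBall (h𝒯 : IsTileset 𝒯) (hT : T ∈ fullShift 𝒯) (R : ℝ) :
    {t ∈ T | (t ∩ closedBall 0 R).Nonempty}.Finite := by
  obtain ⟨M, -, hM⟩ := h𝒯.exists_bound
  obtain ⟨ρ, hρ, hρ'⟩ := h𝒯.exists_inradius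
  have hz : ∀ t ∈ T, ∃ z, ball z ρ ⊆ interior t := fun t ht => exists_ball_subset_tile hρ' hT ht
  choose! z hz using hz
  obtain ⟨F, hF, hcov⟩ := Metric.totallyBounded_iff.1
    (isCompact_closedBall (0 : Space d) (R + 2 * M)).totallyBounded (ρ / 2) (half_pos hρ)
  have hg : ∀ t ∈ {t ∈ T | (t ∩ closedBall 0 R).Nonempty}, ∃ y ∈ F, z t ∈ ball y (ρ / 2) := by
    rintro t ⟨ht, y, hy, hyR⟩
    have h1 : z t ∈ t := interior_subset (hz t ht (mem_ball_self hρ))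
    have h2 := dist_le_of_mem_tile hM hT ht h1 hy
    have h3 : z t ∈ closedBall (0 : Space d) (R + 2 * M) := by
      rw [mem_closedBall] at hyR ⊢
      linarith [dist_triangle (z t) y 0]
    simpa using hcov h3
  choose! g hg using hg
  refine Set.Finite.of_injOn (f := g) (fun t ht => (hg t ht).1) ?_ hF
  intro t ht t' ht' heq
  have h1 := (hg t ht).2
  have h2 := (hg t' ht').2
  rw [← heq] at h2
  rw [mem_ball] at h1 h2
  refine eq_of_mem_interior h𝒯 hT ht.1 ht'.1 (z := z t') (hz t ht.1 ?_)
    (interior_subset (hz t' ht'.1 (mem_ball_self hρ)))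
  rw [mem_ball]
  linarith [dist_triangle_right (z t') (z t) (g t)]

/-! ### Holes and smallest patches -/

/-- A tile covered by a subfamily of its tiling belongs to the subfamily. -/
theorem mem_of_subset_sUnion (h𝒯 : IsTileset 𝒯) (hT : T ∈ fullShift 𝒯) (hP : P ⊆ T)
    (ht : t ∈ T) (h : t ⊆ ⋃₀ P) : t ∈ P := by
  have hti := isTile_of_mem h𝒯 hT ht
  have hne : (interior t).Nonempty := by
    rw [← closure_nonempty_iff, hti.2.2]; exact hti.1
  obtain ⟨z, hz⟩ := hne
  obtain ⟨t', ht', hz'⟩ := h (interior_subset hz)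
  rwa [eq_of_mem_interior h𝒯 hT ht (hP ht') hz hz']

/-- If a subfamily of a tiling covers a ball, then it contains all the tiles that meet the
open ball. -/
theorem mem_of_inter_ball_nonempty (h𝒯 : IsTileset 𝒯) (hT : T ∈ fullShift 𝒯) (hP : P ⊆ T)
    {r : ℝ} (hr : ball 0 r ⊆ ⋃₀ P) (ht : t ∈ T) (h : (t ∩ ball 0 r).Nonempty) : t ∈ P := by
  obtain ⟨y, hy, hyr⟩ := h
  rw [← (isTile_of_mem h𝒯 hT ht).2.2] at hy
  obtain ⟨w, hw, hw'⟩ := mem_closure_iff.1 hy _ isOpen_ball hyr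
  obtain ⟨t', ht', hz'⟩ := hr hw
  rwa [eq_of_mem_interior h𝒯 hT ht (hP ht') hw' hz']

theorem isConnected_tile (hconn : ∀ p ∈ 𝒯, IsConnected (interior p)) (h𝒯 : IsTileset 𝒯)
    (hT : T ∈ fullShift 𝒯) (ht : t ∈ T) : IsConnected (interior t) ∧ IsConnected t := by
  have h : IsConnected (interior t) := by
    obtain ⟨p, hp, x, rfl⟩ := hT.1 t ht
    rw [interior_vadd]
    exact (hconn p hp).image (fun y => x +ᵥ y) (by fun_prop)
  refine ⟨h, ?_⟩
  have := h.closure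
  rwa [(isTile_of_mem h𝒯 hT ht).2.2] at this

/-- The bounded components of the complement of a set lie in every ball that contains the set,
since the complement of a ball is a union of rays. -/
theorem norm_le_of_isBounded_component {S : Set (Space d)} {R : ℝ} (hR : 0 < R)
    (hS : S ⊆ closedBall 0 R) {y : Space d}
    (hb : Bornology.IsBounded (connectedComponentIn Sᶜ y)) : ‖y‖ ≤ R := by
  by_contra! hy
  have hpre : IsPreconnected ((fun a : ℝ => a • y) '' Ici 1) :=
    isPreconnected_Ici.image _ (by fun_prop)
  have hsub : (fun a : ℝ => a • y) '' Ici 1 ⊆ Sᶜ := by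
    rintro _ ⟨a, ha, rfl⟩ h
    have h1 := hS h
    rw [mem_closedBall, dist_zero_right] at h1
    simp only [norm_smul, Real.norm_eq_abs] at h1
    rw [mem_Ici] at ha
    rw [abs_of_nonneg (by linarith)] at h1
    nlinarith
  have hy1 : y ∈ (fun a : ℝ => a • y) '' Ici 1 := ⟨1, by simp, by simp⟩
  have := hb.subset (hpre.subset_connectedComponentIn hy1 hsub)
  obtain ⟨C, hC⟩ := this.subset_closedBall 0
  have h1 : (max 1 (C / R + 1)) • y ∈ closedBall (0 : Space d) C :=
    hC ⟨_, mem_Ici.2 (le_max_left _ _), rfl⟩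
  rw [mem_closedBall, dist_zero_right, norm_smul, Real.norm_eq_abs,
    abs_of_nonneg (by positivity)] at h1
  have h2 : C / R + 1 ≤ max 1 (C / R + 1) := le_max_right _ _
  have h3 : (0 : ℝ) < max 1 (C / R + 1) := by positivity
  have h4 : (C / R + 1) * R = C + R := by field_simp
  nlinarith

/-- The hull of a set: its union with the bounded components of its complement. -/
def hull (S : Set (Space d)) : Set (Space d) :=
  S ∪ {y | y ∈ Sᶜ ∧ Bornology.IsBounded (connectedComponentIn Sᶜ y)}

theorem subset_hull (S : Set (Space d)) : S ⊆ hull S := subset_union_left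

theorem hull_subset_closedBall {S : Set (Space d)} {R : ℝ} (hR : 0 < R)
    (hS : S ⊆ closedBall 0 R) : hull S ⊆ closedBall 0 R := by
  rintro y (hy | ⟨-, hy⟩)
  · exact hS hy
  · simpa using norm_le_of_isBounded_component hR hS hy

/-- A set without holes contains the hull of each of its subsets. -/
theorem hull_subset_of_no_holes {S S' : Set (Space d)} (h : S ⊆ S')
    (hS' : ∀ y ∈ S'ᶜ, ¬ Bornology.IsBounded (connectedComponentIn S'ᶜ y)) : hull S ⊆ S' := by
  rintro y (hy | ⟨-, hy⟩)
  · exact h hy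
  · by_contra hyS
    exact hS' y hyS (hy.subset (connectedComponentIn_mono y (compl_subset_compl.2 h)))

theorem no_holes_hull (S : Set (Space d)) :
    ∀ y ∈ (hull S)ᶜ, ¬ Bornology.IsBounded (connectedComponentIn (hull S)ᶜ y) := by
  intro y hy hb
  have hyS : y ∈ Sᶜ := fun h => hy (subset_hull S h)
  have hunb : ¬ Bornology.IsBounded (connectedComponentIn Sᶜ y) := fun h => hy (Or.inr ⟨hyS, h⟩)
  refine hunb (hb.subset (isPreconnected_connectedComponentIn.subset_connectedComponentIn
    (mem_connectedComponentIn hyS) ?_))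
  rintro z hz (hzS | ⟨-, hzb⟩)
  · exact connectedComponentIn_subset _ _ hz hzS
  · rw [← connectedComponentIn_eq hz] at hzb
    exact hunb hzb

/-- The boundary of a component of the complement of `S` lies in `S`. -/
theorem closure_component_subset {S : Set (Space d)} (y : Space d) :
    closure (connectedComponentIn Sᶜ y) ⊆ S ∪ connectedComponentIn Sᶜ y := by
  intro w hw
  by_cases hwS : w ∈ S
  · exact Or.inl hwS
  right
  by_cases hy : y ∈ Sᶜ
  · refine IsPreconnected.subset_connectedComponentIn (s := insert w (connectedComponentIn Sᶜ y))
      (isPreconnected_connectedComponentIn.subset_closure (subset_insert _ _)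
        (insert_subset hw subset_closure))
      (mem_insert_of_mem _ (mem_connectedComponentIn hy))
      (insert_subset hwS (connectedComponentIn_subset _ _)) (mem_insert _ _)
  · rw [connectedComponentIn_eq_empty hy] at hw
    simp at hw

theorem component_subset_hull {S : Set (Space d)} {y : Space d}
    (hb : Bornology.IsBounded (connectedComponentIn Sᶜ y)) :
    connectedComponentIn Sᶜ y ⊆ hull S := fun z hz =>
  Or.inr ⟨connectedComponentIn_subset _ _ hz, by rwa [← connectedComponentIn_eq hz]⟩

theorem isConnected_hull {S : Set (Space d)} (hS : IsConnected S) (hcl : IsClosed S) :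
    IsConnected (hull S) := by
  obtain ⟨x, hx⟩ := hS.1
  refine ⟨⟨x, subset_hull S hx⟩, isPreconnected_of_forall x ?_⟩
  rintro y (hy | ⟨hyS, hy⟩)
  · exact ⟨S, subset_hull S, hx, hy, hS.2⟩
  refine ⟨S ∪ closure (connectedComponentIn Sᶜ y), ?_, Or.inl hx,
    Or.inr (subset_closure (mem_connectedComponentIn hyS)), ?_⟩
  · refine union_subset (subset_hull S) ((closure_component_subset y).trans
      (union_subset (subset_hull S) (component_subset_hull hy)))
  · -- A component whose closure misses `S` would be open and closed.
    have hmeet : (S ∩ closure (connectedComponentIn Sᶜ y)).Nonempty := by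
      by_contra hne
      rw [not_nonempty_iff_eq_empty] at hne
      have hclosed : IsClosed (connectedComponentIn Sᶜ y) := by
        refine isClosed_of_closure_subset fun w hw => ?_
        refine (closure_component_subset y hw).resolve_left fun hwS => ?_
        exact (hne ▸ (⟨hwS, hw⟩ : w ∈ S ∩ _) : w ∈ (∅ : Set (Space d)))
      have huniv := IsClopen.eq_univ ⟨hclosed, hcl.isOpen_compl.connectedComponentIn⟩
        ⟨y, mem_connectedComponentIn hyS⟩
      have : x ∈ connectedComponentIn Sᶜ y := by rw [huniv]; trivial
      exact connectedComponentIn_subset _ _ this hx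
    obtain ⟨w, hw, hw'⟩ := hmeet
    exact hS.2.union w hw hw' isPreconnected_connectedComponentIn.closure

/-- The smallest patch around a ball is itself a patch: it consists of the tiles contained in the
hull of the union of the tiles that meet the open ball. -/
theorem minPatch_mem_coverPatches (h𝒯 : IsTileset 𝒯)
    (hconn : ∀ p ∈ 𝒯, IsConnected (interior p)) {M : ℝ} (hM0 : 0 < M)
    (hM : ∀ p ∈ 𝒯, p ⊆ closedBall 0 M) (hT : T ∈ fullShift 𝒯) {r : ℝ} (hr : 0 < r) :
    minPatch T (cball r) ∈ coverPatches T (cball r) ∧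
      ⋃₀ minPatch T (cball r) ⊆ closedBall 0 (r + 2 * M) := by
  set Q : Set (Set (Space d)) := {t ∈ T | (t ∩ ball 0 r).Nonempty} with hQ
  set S := ⋃₀ Q with hS
  have hQT : Q ⊆ T := fun t ht => ht.1
  have hQfin : Q.Finite := (finite_tiles_inter_closedBall h𝒯 hT r).subset
    fun t ht => ⟨ht.1, ht.2.mono (inter_subset_inter_right _ ball_subset_closedBall)⟩
  have hScl : IsClosed S := by
    rw [hS, sUnion_eq_biUnion]
    exact hQfin.isClosed_biUnion fun t ht => (isTile_of_mem h𝒯 hT ht.1).isClosed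
  have hballS : ball 0 r ⊆ S := fun y hy => by
    obtain ⟨t, ht, hyt⟩ := exists_mem_tile hT y
    exact ⟨t, ⟨ht, y, hyt, hy⟩, hyt⟩
  have hcballS : closedBall 0 r ⊆ S := by
    rw [← closure_ball _ hr.ne']
    exact hScl.closure_subset_iff.2 hballS
  have h0 : (0 : Space d) ∈ S := hballS (mem_ball_self hr)
  have hSconn : IsConnected S := by
    refine ⟨⟨0, h0⟩, isPreconnected_of_forall 0 ?_⟩
    rintro y ⟨t, ht, hyt⟩
    obtain ⟨w, hwt, hwr⟩ := ht.2
    exact ⟨ball 0 r ∪ t, union_subset hballS (subset_sUnion_of_mem ht),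
      Or.inl (mem_ball_self hr), Or.inr hyt,
      (convex_ball 0 r).isPreconnected.union w hwr hwt
        (isConnected_tile hconn h𝒯 hT ht.1).2.2⟩
  have hSM : S ⊆ closedBall 0 (r + 2 * M) := by
    rintro y ⟨t, ht, hyt⟩
    obtain ⟨w, hwt, hwr⟩ := ht.2
    have := dist_le_of_mem_tile hM hT ht.1 hyt hwt
    rw [mem_ball] at hwr
    rw [mem_closedBall]
    linarith [dist_triangle y w 0]
  have hHM := hull_subset_closedBall (by positivity) hSM
  set P : Set (Set (Space d)) := {t ∈ T | t ⊆ hull S} with hP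
  have hPT : P ⊆ T := fun t ht => ht.1
  -- A tile containing a point of a bounded component has its interior in this component.
  have hsupp : ⋃₀ P = hull S := by
    apply Subset.antisymm
    · exact sUnion_subset fun t ht => ht.2
    rintro y (⟨t, ht, hyt⟩ | ⟨hyS, hyb⟩)
    · exact ⟨t, ⟨ht.1, (subset_sUnion_of_mem ht).trans (subset_hull S)⟩, hyt⟩
    obtain ⟨t, ht, hyt⟩ := exists_mem_tile hT y
    refine ⟨t, ⟨ht, ?_⟩, hyt⟩
    have hdisj : interior t ⊆ Sᶜ := by
      rintro z hz ⟨t', ht', hz'⟩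
      rw [← eq_of_mem_interior h𝒯 hT ht ht'.1 hz hz'] at ht'
      exact hyS ⟨t, ht', hyt⟩
    rw [← (isTile_of_mem h𝒯 hT ht).2.2] at hyt ⊢
    obtain ⟨z, hzC, hzt⟩ := mem_closure_iff.1 hyt _
      (hScl.isOpen_compl.connectedComponentIn (x := y)) (mem_connectedComponentIn hyS)
    have hsub : interior t ⊆ connectedComponentIn Sᶜ y := by
      rw [connectedComponentIn_eq hzC]
      exact (isConnected_tile hconn h𝒯 hT ht).1.2.subset_connectedComponentIn hzt hdisj
    exact (closure_mono hsub).trans ((closure_component_subset y).trans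
      (union_subset (subset_hull S) (component_subset_hull hyb)))
  have hPpatch : P ∈ coverPatches T (cball r) := by
    refine ⟨⟨hPT, ?_, ?_, ?_⟩, ?_⟩
    · refine (finite_tiles_inter_closedBall h𝒯 hT (r + 2 * M)).subset fun t ht => ⟨ht.1, ?_⟩
      rw [inter_eq_left.2 (ht.2.trans hHM)]
      exact (isTile_of_mem h𝒯 hT ht.1).1
    · rw [hsupp]; exact isConnected_hull hSconn hScl
    · rw [hsupp]; exact no_holes_hull S
    · rw [hsupp]; exact hcballS.trans (subset_hull S)
  have hmin : minPatch T (cball r) = P := by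
    apply Subset.antisymm
    · exact sInter_subset_of_mem hPpatch
    · intro t ht P' hP'
      have hQP' : Q ⊆ P' := fun t ht => mem_of_inter_ball_nonempty h𝒯 hT hP'.1.1
        (ball_subset_closedBall.trans hP'.2) ht.1 ht.2
      exact mem_of_subset_sUnion h𝒯 hT hP'.1.1 ht.1
        (ht.2.trans (hull_subset_of_no_holes (sUnion_subset_sUnion hQP') hP'.1.2.2.2))
  rw [hmin, hsupp]
  exact ⟨hPpatch, hHM⟩

/-! ### The Hausdorff distance between translates -/

theorem IsTile.hausdorffEDist_ne_top (ht : IsTile t) (ht' : IsTile t') :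
    hausdorffEDist t t' ≠ ⊤ :=
  hausdorffEDist_ne_top_of_nonempty_of_bounded ht.1 ht'.1 ht.2.1.isBounded ht'.2.1.isBounded

theorem hausdorffDist_vadd_le (t : Set (Space d)) (x : Space d) :
    hausdorffDist (x +ᵥ t) t ≤ ‖x‖ := by
  refine hausdorffDist_le_of_mem_dist (norm_nonneg x) ?_ ?_
  · rintro _ ⟨y, hy, rfl⟩
    exact ⟨y, hy, by simp [dist_eq_norm]⟩
  · intro y hy
    exact ⟨x + y, ⟨y, hy, rfl⟩, by simp [dist_eq_norm]⟩

/-- A translation moves a nonempty compact set, in the Hausdorff distance, by exactly its length: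
look at a point of the set that is extreme in the direction of the translation. -/
theorem IsTile.hausdorffDist_vadd (ht : IsTile t) (x : Space d) :
    hausdorffDist (x +ᵥ t) t = ‖x‖ := by
  refine le_antisymm (hausdorffDist_vadd_le t x) ?_
  by_contra! hlt
  obtain ⟨y, hy, hmax⟩ := ht.2.1.exists_isMaxOn ht.1
    (f := fun y => inner ℝ x y) (by fun_prop)
  obtain ⟨z, hz, hyz⟩ := exists_dist_lt_of_hausdorffDist_lt (x := x + y)
    (mem_image_of_mem _ hy) hlt
    ((ht.vadd x).hausdorffEDist_ne_top ht)
  have h1 : inner ℝ x z ≤ inner ℝ x y := hmax hz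
  have h2 : inner ℝ x (x + y - z) ≤ ‖x‖ * ‖x + y - z‖ := real_inner_le_norm _ _
  rw [inner_sub_right, inner_add_right, real_inner_self_eq_norm_sq] at h2
  rw [dist_eq_norm] at hyz
  have h3 : 0 < ‖x‖ := (norm_nonneg _).trans_lt hyz
  nlinarith

theorem IsTile.hausdorffDist_triangle {t₁ t₂ t₃ : Set (Space d)} (h₁ : IsTile t₁)
    (h₂ : IsTile t₂) :
    hausdorffDist t₁ t₃ ≤ hausdorffDist t₁ t₂ + hausdorffDist t₂ t₃ :=
  Metric.hausdorffDist_triangle (h₁.hausdorffEDist_ne_top h₂)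

theorem IsTile.exists_dist_lt {r : ℝ} (ht : IsTile t) (ht' : IsTile t')
    (h : hausdorffDist t t' < r) {y : Space d} (hy : y ∈ t) : ∃ z ∈ t', dist y z < r :=
  exists_dist_lt_of_hausdorffDist_lt hy h (ht.hausdorffEDist_ne_top ht')

theorem hausdorffDist_vadd_vadd (x : Space d) (t t' : Set (Space d)) :
    hausdorffDist (x +ᵥ t) (x +ᵥ t') = hausdorffDist t t' := by
  have : Isometry (fun y : Space d => x +ᵥ y) := isometry_vadd _ x
  exact hausdorffDist_image this

/-- Distinct tiles of a tiling are at least an inradius apart. -/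
theorem eq_of_hausdorffDist_lt (h𝒯 : IsTileset 𝒯) {ρ : ℝ} (hρ0 : 0 < ρ)
    (hρ : ∀ p ∈ 𝒯, ∃ z, ball z ρ ⊆ p)
    (hT : T ∈ fullShift 𝒯) (ht : t ∈ T) (ht' : t' ∈ T) (h : hausdorffDist t t' < ρ) : t = t' := by
  obtain ⟨z, hz⟩ := exists_ball_subset_tile hρ hT ht
  obtain ⟨w, hw, hzw⟩ := (isTile_of_mem h𝒯 hT ht).exists_dist_lt (isTile_of_mem h𝒯 hT ht') h
    (interior_subset (hz (mem_ball_self hρ0)))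
  exact eq_of_mem_interior h𝒯 hT ht ht' (hz (by rwa [mem_ball'])) hw

/-- Two tiles that are not translates of each other have a positive distance up to translation,
because `x ↦ H(t, x + t')` is continuous and tends to infinity, so attains its minimum. -/
theorem IsTile.exists_pos_translate (ht : IsTile t) (ht' : IsTile t') :
    ∃ c > 0, ∀ x : Space d, hausdorffDist t (x +ᵥ t') < c → ∃ y : Space d, t = y +ᵥ t' := by
  set f : Space d → ℝ := fun x => hausdorffDist t (x +ᵥ t') with hf
  have hstep : ∀ x y, f x ≤ f y + ‖x - y‖ := fun x y => by
    have h1 := ht.hausdorffDist_triangle (t₃ := x +ᵥ t') (ht'.vadd y)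
    have h2 := hausdorffDist_vadd_le (y +ᵥ t') (x - y)
    rw [vadd_vadd, sub_add_cancel, hausdorffDist_comm] at h2
    simp only [hf]
    linarith
  have hcont : Continuous f := by
    refine continuous_iff_continuousAt.2 fun x => ?_
    rw [ContinuousAt, tendsto_iff_dist_tendsto_zero]
    refine squeeze_zero (fun _ => dist_nonneg) (g := fun y => ‖y - x‖) (fun y => ?_) ?_
    · rw [Real.dist_eq, abs_le]
      have h1 := hstep x y
      have h2 := hstep y x
      rw [norm_sub_rev] at h1
      constructor <;> linarith
    · have : Filter.Tendsto (fun y : Space d => ‖y - x‖) (nhds x) (nhds ‖x - x‖) :=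
        Continuous.tendsto (by fun_prop) x
      simpa using this
  have htop : Filter.Tendsto f (Filter.cocompact _) Filter.atTop := by
    refine Filter.tendsto_atTop_mono (f := fun x => ‖x‖ + -f 0) (fun x => ?_)
      (Filter.tendsto_atTop_add_const_right _ _ tendsto_norm_cocompact_atTop)
    have h1 := (ht'.vadd x).hausdorffDist_triangle (t₃ := t') ht
    rw [ht'.hausdorffDist_vadd, hausdorffDist_comm] at h1
    simp only [hf, zero_vadd]
    linarith
  obtain ⟨y, hy⟩ := hcont.exists_forall_le htop
  by_cases h0 : f y = 0
  · refine ⟨1, one_pos, fun _ _ => ⟨y, ?_⟩⟩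
    exact (ht.isClosed.hausdorffDist_zero_iff_eq (ht'.vadd y).isClosed
      (ht.hausdorffEDist_ne_top (ht'.vadd y))).1 h0
  · refine ⟨f y, lt_of_le_of_ne hausdorffDist_nonneg (Ne.symm h0), fun x hx => ?_⟩
    exact absurd (hy x) (not_le.2 hx)

/-- Tiles that are close enough to each other are translates of each other. -/
theorem IsTileset.exists_pos_translate (h𝒯 : IsTileset 𝒯) :
    ∃ c > 0, ∀ T₀ ∈ fullShift 𝒯, ∀ T₁ ∈ fullShift 𝒯, ∀ t₀ ∈ T₀, ∀ t₁ ∈ T₁,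
      hausdorffDist t₀ t₁ < c → ∃ x : Space d, t₁ = x +ᵥ t₀ := by
  obtain ⟨c, hc, h⟩ := exists_pos_forall_of_finite (s := 𝒯 ×ˢ 𝒯) (h𝒯.1.prod h𝒯.1)
    (Q := fun pp c => ∀ x : Space d, hausdorffDist pp.1 (x +ᵥ pp.2) < c →
      ∃ y : Space d, pp.1 = y +ᵥ pp.2)
    (fun pp a b hab h x hx => h x (hx.trans_le hab))
    (fun pp hpp => (h𝒯.2 _ hpp.1).exists_pos_translate (h𝒯.2 _ hpp.2))
  refine ⟨c, hc, fun T₀ hT₀ T₁ hT₁ t₀ ht₀ t₁ ht₁ hlt => ?_⟩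
  obtain ⟨p, hp, x, rfl⟩ := hT₀.1 t₀ ht₀
  obtain ⟨q, hq, y, rfl⟩ := hT₁.1 t₁ ht₁
  rw [← hausdorffDist_vadd_vadd (-x), vadd_vadd, vadd_vadd] at hlt
  simp only [neg_add_cancel, zero_vadd] at hlt
  obtain ⟨z, hz⟩ := h (p, q) ⟨hp, hq⟩ _ hlt
  simp only at hz
  refine ⟨y - z - x, ?_⟩
  rw [hz, vadd_vadd, vadd_vadd]
  congr 1
  abel

/-! ### Finite local complexity and rigidity -/

/-- The displacements of length at most `R` between the tiles of the tilings in `X`, where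
each tile is located by the translation that carries its prototile to it. -/
def displacements (𝒯 : Set (Set (Space d))) (X : Set (Set (Set (Space d)))) (R : ℝ) :
    Set (Space d) :=
  {v | ‖v‖ ≤ R ∧ ∃ p ∈ 𝒯, ∃ p' ∈ 𝒯, ∃ T ∈ X, ∃ y : Space d, y +ᵥ p ∈ T ∧ (y + v) +ᵥ p' ∈ T}

theorem IsTile.vadd_injective (ht : IsTile t) {x y : Space d} (h : x +ᵥ t = y +ᵥ t) : x = y := by
  have h1 := ht.hausdorffDist_vadd (-y + x)
  rw [← vadd_vadd, h, vadd_vadd, neg_add_cancel, zero_vadd, hausdorffDist_self_zero] at h1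
  exact (neg_add_eq_zero.1 (norm_eq_zero.1 h1.symm)).symm

/-- Under finite local complexity there are finitely many displacements of bounded length: two
tiles at bounded distance lie in a patch of bounded size, and there are finitely many of these. -/
theorem finite_displacements (h𝒯 : IsTileset 𝒯)
    (hconn : ∀ p ∈ 𝒯, IsConnected (interior p)) (hX : X ⊆ fullShift 𝒯)
    (hinv : ∀ T ∈ X, ∀ x : Space d, x +ᵥ T ∈ X) (hFLC : FLC X) (R : ℝ) :
    (displacements 𝒯 X R).Finite := by
  obtain ⟨M, hM0, hM⟩ := h𝒯.exists_bound
  set r : ℝ := max R 0 + M + 1 with hr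
  have hRr : R + M < r := by linarith [le_max_left R 0]
  have hr0 : 0 < r := by positivity
  have hMr : M < r := by linarith [le_max_right R 0]
  obtain ⟨F, hF, hFX⟩ := hFLC (closedBall 0 (r + 2 * M)) (isCompact_closedBall _ _)
  set G : Set (Set (Space d)) := ⋃ Q ∈ {Q ∈ F | Q.Finite}, Q with hG
  have hGfin : G.Finite := (hF.subset (sep_subset _ _)).biUnion fun Q hQ => hQ.2
  -- `v` is determined by two prototiles and by the members of a representative `Q` of the patch
  -- that correspond to the two tiles; these data range over a finite set.
  have key : ∀ v ∈ displacements 𝒯 X R, ∃ a : (Set (Space d) × Set (Space d)) ×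
      (Set (Space d) × Set (Space d)), a ∈ (𝒯 ×ˢ 𝒯) ×ˢ (G ×ˢ G) ∧
      ∃ z : Space d, a.1.1 = z +ᵥ a.2.1 ∧ v +ᵥ a.1.2 = z +ᵥ a.2.2 := by
    rintro v ⟨hv, p, hp, p', hp', T, hTX, y, h1, h2⟩
    have hTy := hinv T hTX (-y)
    obtain ⟨hpatch, hsupp⟩ := minPatch_mem_coverPatches h𝒯 hconn hM0 hM (hX hTy) hr0
    obtain ⟨Q, hQ, z, hz⟩ := hFX _ ⟨_, hTy, hpatch.1⟩ hsupp
    have hQfin : Q.Finite := by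
      have := hpatch.1.2.1
      rw [hz] at this
      exact Set.Finite.of_finite_image this (AddAction.injective z).injOn
    have hmem : ∀ q ∈ -y +ᵥ T, (q ∩ ball 0 r).Nonempty → ∃ q' ∈ G, q = z +ᵥ q' := by
      intro q hq hne
      have h3 := mem_of_inter_ball_nonempty h𝒯 (hX hTy) hpatch.1.1
        (ball_subset_closedBall.trans hpatch.2) hq hne
      rw [hz] at h3
      obtain ⟨q', hq', rfl⟩ := h3
      exact ⟨q', mem_biUnion (x := Q) ⟨hQ, hQfin⟩ hq', rfl⟩
    have hpT : p ∈ -y +ᵥ T := ⟨_, h1, by simp [vadd_vadd]⟩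
    have hpT' : v +ᵥ p' ∈ -y +ᵥ T := ⟨_, h2, by simp [vadd_vadd]⟩
    obtain ⟨a, ha⟩ := (h𝒯.2 p hp).1
    obtain ⟨b, hb⟩ := (h𝒯.2 p' hp').1
    have haM := hM p hp ha
    have hbM := hM p' hp' hb
    rw [mem_closedBall, dist_zero_right] at haM hbM
    obtain ⟨q, hq, hpq⟩ := hmem p hpT ⟨a, ha, by rw [mem_ball, dist_zero_right]; linarith⟩
    obtain ⟨q', hq', hpq'⟩ := hmem (v +ᵥ p') hpT' ⟨v + b, ⟨b, hb, rfl⟩, by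
      rw [mem_ball, dist_zero_right]; linarith [norm_add_le v b]⟩
    exact ⟨((p, p'), (q, q')), ⟨⟨hp, hp'⟩, hq, hq'⟩, z, hpq, hpq'⟩
  choose! a ha using key
  refine Set.Finite.of_injOn (f := a) (fun v hv => (ha v hv).1) ?_
    ((h𝒯.1.prod h𝒯.1).prod (hGfin.prod hGfin))
  intro v hv w hw hvw
  obtain ⟨hmem, z, h1, h2⟩ := ha v hv
  obtain ⟨-, z', h1', h2'⟩ := ha w hw
  rw [← hvw] at h1' h2'
  have hp : IsTile (a v).1.1 := h𝒯.2 _ hmem.1.1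
  have hp' : IsTile (a v).1.2 := h𝒯.2 _ hmem.1.2
  have hz : z = z' := by
    have h3 : (a v).2.1 = -z +ᵥ (a v).1.1 := by rw [h1, vadd_vadd]; simp
    rw [h3, vadd_vadd] at h1'
    have := hp.vadd_injective (x := 0) (y := z' + -z) (by rw [zero_vadd]; exact h1')
    exact (add_neg_eq_zero.1 this.symm).symm
  exact hp'.vadd_injective (h2.trans (hz ▸ h2'.symm))

/-- Distinct points of a finite set are separated. -/
theorem exists_pos_separation {s : Set (Space d)} (hs : s.Finite) :
    ∃ δ > 0, ∀ v ∈ s, ∀ w ∈ s, ‖v - w‖ < δ → v = w := by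
  obtain ⟨δ, hδ, h⟩ := exists_pos_forall_of_finite (hs.prod hs)
    (Q := fun vw δ => ‖vw.1 - vw.2‖ < δ → vw.1 = vw.2)
    (fun _ a b hab h hlt => h (hlt.trans_le hab)) (fun vw _ => by
      by_cases h : vw.1 = vw.2
      · exact ⟨1, one_pos, fun _ => h⟩
      · exact ⟨‖vw.1 - vw.2‖, norm_pos_iff.2 (sub_ne_zero.2 h), fun hlt => absurd hlt (lt_irrefl _)⟩)
  exact ⟨δ, hδ, fun v hv w hw => h (v, w) ⟨hv, hw⟩⟩

/-- A function on a finite family of closed sets with connected union is constant if it takes the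
same value on any two members that intersect. -/
theorem eq_of_isPreconnected_sUnion {A : Type*} {S : Set (Set (Space d))} (hfin : S.Finite)
    (hcl : ∀ t ∈ S, IsClosed t) (hne : ∀ t ∈ S, t.Nonempty) (hconn : IsPreconnected (⋃₀ S))
    {g : Set (Space d) → A} (hg : ∀ t ∈ S, ∀ t' ∈ S, (t ∩ t').Nonempty → g t = g t') :
    ∀ t ∈ S, ∀ t' ∈ S, g t = g t' := by
  intro t ht t' ht'
  by_contra hneq
  have hclosed : ∀ p : Set (Space d) → Prop, IsClosed (⋃ u ∈ {u ∈ S | p u}, u) := fun p =>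
    (hfin.subset (sep_subset _ _)).isClosed_biUnion fun u hu => hcl u hu.1
  obtain ⟨x, hx⟩ := hne t ht
  obtain ⟨y, hy⟩ := hne t' ht'
  obtain ⟨z, -, hz, hz'⟩ := isPreconnected_closed_iff.1 hconn _ _
    (hclosed fun u => g u = g t) (hclosed fun u => g u ≠ g t)
    (by
      rintro w ⟨u, hu, hw⟩
      by_cases h : g u = g t
      · exact Or.inl (mem_biUnion (x := u) ⟨hu, h⟩ hw)
      · exact Or.inr (mem_biUnion (x := u) ⟨hu, h⟩ hw))
    ⟨x, ⟨t, ht, hx⟩, mem_biUnion (x := t) ⟨ht, rfl⟩ hx⟩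
    ⟨y, ⟨t', ht', hy⟩, mem_biUnion (x := t') ⟨ht', Ne.symm hneq⟩ hy⟩
  simp only [mem_iUnion] at hz hz'
  obtain ⟨u, ⟨hu, hgu⟩, hzu⟩ := hz
  obtain ⟨u', ⟨hu', hgu'⟩, hzu'⟩ := hz'
  exact hgu' ((hg u' hu' u hu ⟨z, hzu', hzu⟩).trans hgu)

/-- Rigidity: if every tile of a connected finite part of a tiling of `X` is close to some tile of
another tiling of `X`, then a single translation carries these tiles to those close to them.
Close tiles are translates of each other, and by finite local complexity the translation vectors
of two intersecting tiles cannot differ by a small nonzero amount. -/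
theorem exists_rigidity_constant (h𝒯 : IsTileset 𝒯)
    (hconn : ∀ p ∈ 𝒯, IsConnected (interior p)) (hX : X ⊆ fullShift 𝒯)
    (hinv : ∀ T ∈ X, ∀ x : Space d, x +ᵥ T ∈ X) (hFLC : FLC X) :
    ∃ c > 0, ∀ ε ≤ c, ∀ T₀ ∈ X, ∀ T₁ ∈ X, ∀ S ⊆ T₀, S.Finite → IsConnected (⋃₀ S) →
      (∀ t ∈ S, ∃ t' ∈ T₁, hausdorffDist t t' ≤ ε) →
      ∃ x : Space d, ‖x‖ ≤ ε ∧ x +ᵥ S ⊆ T₁ := by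
  obtain ⟨M, hM0, hM⟩ := h𝒯.exists_bound
  obtain ⟨c₁, hc₁, htr⟩ := h𝒯.exists_pos_translate
  obtain ⟨δ, hδ, hsep⟩ := exists_pos_separation
    (finite_displacements h𝒯 hconn hX hinv hFLC (2 * M + 2))
  set c := min 1 (min (c₁ / 2) (δ / 4)) with hc
  have hc0 : 0 < c := by positivity
  have hc1 : c ≤ 1 := min_le_left _ _
  have hcc : c < c₁ := by
    have : c ≤ c₁ / 2 := (min_le_right _ _).trans (min_le_left _ _)
    linarith
  have hcδ : 2 * c < δ := by
    have : c ≤ δ / 4 := (min_le_right _ _).trans (min_le_right _ _)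
    linarith
  refine ⟨c, hc0, fun ε hε T₀ hT₀ T₁ hT₁ S hS hfin hSconn hclose => ?_⟩
  have hx : ∀ t ∈ S, ∃ x : Space d, ‖x‖ ≤ ε ∧ x +ᵥ t ∈ T₁ := by
    intro t ht
    obtain ⟨t', ht', h⟩ := hclose t ht
    obtain ⟨x, rfl⟩ := htr T₀ (hX hT₀) T₁ (hX hT₁) t (hS ht) t' ht' ((h.trans hε).trans_lt hcc)
    refine ⟨x, ?_, ht'⟩
    rwa [hausdorffDist_comm,
      (isTile_of_mem h𝒯 (hX hT₀) (hS ht)).hausdorffDist_vadd] at h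
  choose! g hgc hgT using hx
  have hg : ∀ t ∈ S, ∀ t' ∈ S, (t ∩ t').Nonempty → g t = g t' := by
    intro t ht t' ht' hne
    have hgt := hgT t ht
    have hgt' := hgT t' ht'
    obtain ⟨p, hp, y, hty⟩ := (hX hT₀).1 t (hS ht)
    obtain ⟨p', hp', y', hty'⟩ := (hX hT₀).1 t' (hS ht')
    obtain ⟨w, hw, hw'⟩ := hne
    rw [hty] at hw
    rw [hty'] at hw'
    obtain ⟨a, ha, hwa⟩ := hw
    obtain ⟨b, hb, hwb⟩ := hw'
    have haM := hM p hp ha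
    have hbM := hM p' hp' hb
    rw [mem_closedBall, dist_zero_right] at haM hbM
    have hab : y' - y = a - b := by
      have : y + a = y' + b := hwa.trans hwb.symm
      rw [sub_eq_sub_iff_add_eq_add, ← this, add_comm]
    have hv : ‖y' - y‖ ≤ 2 * M := by rw [hab]; linarith [norm_sub_le a b]
    -- The relative positions of the two tiles, before and after moving them by `g t` and `g t'`.
    have h1 : y' - y ∈ displacements 𝒯 X (2 * M + 2) :=
      ⟨by linarith, p, hp, p', hp', T₀, hT₀, y, hty ▸ hS ht, by
        rw [add_sub_cancel, ← hty']; exact hS ht'⟩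
    have h2 : (g t' + y') - (g t + y) ∈ displacements 𝒯 X (2 * M + 2) := by
      refine ⟨?_, p, hp, p', hp', T₁, hT₁, g t + y, ?_, ?_⟩
      · have e : (g t' + y') - (g t + y) = (y' - y) + (g t' - g t) := by abel
        rw [e]
        linarith [norm_add_le (y' - y) (g t' - g t), norm_sub_le (g t') (g t), hgc t ht,
          hgc t' ht']
      · rw [← vadd_vadd, ← hty]; exact hgt
      · rw [add_sub_cancel, ← vadd_vadd, ← hty']; exact hgt'
    have h3 := hsep _ h2 _ h1 (by
      have e : (g t' + y') - (g t + y) - (y' - y) = g t' - g t := by abel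
      rw [e]
      linarith [norm_sub_le (g t') (g t), hgc t ht, hgc t' ht'])
    have e : g t' - g t = (g t' + y') - (g t + y) - (y' - y) := by abel
    rw [h3, sub_self, sub_eq_zero] at e
    exact e.symm
  have htile : ∀ t ∈ S, IsTile t := fun t ht => isTile_of_mem h𝒯 (hX hT₀) (hS ht)
  have hconst := eq_of_isPreconnected_sUnion hfin (fun t ht => (htile t ht).isClosed)
    (fun t ht => (htile t ht).1) hSconn.2 hg
  obtain ⟨w, t₀, ht₀, -⟩ := hSconn.1
  refine ⟨g t₀, hgc t₀ ht₀, ?_⟩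
  rintro _ ⟨t, ht, rfl⟩
  simp only
  rw [hconst t₀ ht₀ t ht]
  exact hgT t ht

/-! ### The distance between patches -/

theorem IsPatch.nonempty (h : IsPatch T P) : P.Nonempty := by
  obtain ⟨y, t, ht, -⟩ := h.2.2.1.1
  exact ⟨t, ht⟩

theorem bddBelow_hausdorffDist (s : Set (Space d)) (P : Set (Set (Space d))) :
    BddBelow (range fun t : P => hausdorffDist s (t : Set (Space d))) :=
  ⟨0, by rintro _ ⟨t, rfl⟩; exact hausdorffDist_nonneg⟩

theorem bddBelow_hausdorffDist' (s : Set (Space d)) (P : Set (Set (Space d))) :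
    BddBelow (range fun t : P => hausdorffDist (t : Set (Space d)) s) :=
  ⟨0, by rintro _ ⟨t, rfl⟩; exact hausdorffDist_nonneg⟩

theorem patchDist_le {P₀ P₁ : Set (Set (Space d))} (h₀ : P₀.Nonempty) (h₁ : P₁.Nonempty) {r : ℝ}
    (h : ∀ t₀ ∈ P₀, ∃ t₁ ∈ P₁, hausdorffDist t₀ t₁ ≤ r)
    (h' : ∀ t₁ ∈ P₁, ∃ t₀ ∈ P₀, hausdorffDist t₀ t₁ ≤ r) : patchDist P₀ P₁ ≤ r := by
  have := h₀.to_subtype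
  have := h₁.to_subtype
  refine max_le (ciSup_le fun t₀ => ?_) (ciSup_le fun t₁ => ?_)
  · obtain ⟨t₁, ht₁, hle⟩ := h t₀ t₀.2
    exact (ciInf_le (bddBelow_hausdorffDist _ _) ⟨t₁, ht₁⟩).trans hle
  · obtain ⟨t₀, ht₀, hle⟩ := h' t₁ t₁.2
    exact (ciInf_le (bddBelow_hausdorffDist' _ _) ⟨t₀, ht₀⟩).trans hle

theorem exists_hausdorffDist_le_patchDist {P₀ P₁ : Set (Set (Space d))} (h₀ : P₀.Finite)
    (h₁ : P₁.Finite) (hne : P₁.Nonempty) (ht : t ∈ P₀) :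
    ∃ t₁ ∈ P₁, hausdorffDist t t₁ ≤ patchDist P₀ P₁ := by
  have := h₀.to_subtype
  have := h₁.to_subtype
  have := hne.to_subtype
  obtain ⟨t₁, ht₁⟩ := exists_eq_ciInf_of_finite
    (f := fun t₁ : P₁ => hausdorffDist t (t₁ : Set (Space d)))
  refine ⟨t₁, t₁.2, ht₁.trans_le (le_trans ?_ (le_max_left _ _))⟩
  exact le_ciSup (f := fun t₀ : P₀ => ⨅ t₁ : P₁, hausdorffDist (t₀ : Set (Space d)) t₁)
    (Set.finite_range _).bddAbove ⟨t, ht⟩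

theorem exists_hausdorffDist_le_patchDist' {P₀ P₁ : Set (Set (Space d))} (h₀ : P₀.Finite)
    (h₁ : P₁.Finite) (hne : P₀.Nonempty) (ht : t ∈ P₁) :
    ∃ t₀ ∈ P₀, hausdorffDist t₀ t ≤ patchDist P₀ P₁ := by
  have := h₀.to_subtype
  have := h₁.to_subtype
  have := hne.to_subtype
  obtain ⟨t₀, ht₀⟩ := exists_eq_ciInf_of_finite
    (f := fun t₀ : P₀ => hausdorffDist (t₀ : Set (Space d)) t)
  refine ⟨t₀, t₀.2, ht₀.trans_le (le_trans ?_ (le_max_right _ _))⟩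
  exact le_ciSup (f := fun t₁ : P₁ => ⨅ t₀ : P₀, hausdorffDist (t₀ : Set (Space d)) t₁)
    (Set.finite_range _).bddAbove ⟨t, ht⟩

theorem patchDist_vadd_le (hP : P.Nonempty) (x : Space d) : patchDist (x +ᵥ P) P ≤ ‖x‖ := by
  refine patchDist_le hP.vadd_set hP ?_ ?_
  · rintro _ ⟨t, ht, rfl⟩
    exact ⟨t, ht, hausdorffDist_vadd_le t x⟩
  · intro t ht
    exact ⟨x +ᵥ t, ⟨t, ht, rfl⟩, hausdorffDist_vadd_le t x⟩

theorem sUnion_vadd (x : Space d) (P : Set (Set (Space d))) : ⋃₀ (x +ᵥ P) = x +ᵥ ⋃₀ P := by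
  ext y
  constructor
  · rintro ⟨_, ⟨t, ht, rfl⟩, z, hz, rfl⟩
    exact ⟨z, ⟨t, ht, hz⟩, rfl⟩
  · rintro ⟨z, ⟨t, ht, hz⟩, rfl⟩
    exact ⟨_, ⟨t, ht, rfl⟩, z, hz, rfl⟩

/-- Close patches of tilings of `X` are translates of each other. -/
theorem exists_patchDist_constant (h𝒯 : IsTileset 𝒯)
    (hconn : ∀ p ∈ 𝒯, IsConnected (interior p)) (hX : X ⊆ fullShift 𝒯)
    (hinv : ∀ T ∈ X, ∀ x : Space d, x +ᵥ T ∈ X) (hFLC : FLC X) :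
    ∃ c > 0, c ≤ 1 ∧ ∀ P₀ ∈ patchesOf X, ∀ P₁ ∈ patchesOf X, patchDist P₀ P₁ ≤ c →
      ∃ x : Space d, ‖x‖ = patchDist P₀ P₁ ∧ P₀ = x +ᵥ P₁ := by
  obtain ⟨c, hc, hrig⟩ := exists_rigidity_constant h𝒯 hconn hX hinv hFLC
  obtain ⟨ρ, hρ, hρ'⟩ := h𝒯.exists_inradius
  refine ⟨min c (min 1 (ρ / 4)), by positivity, (min_le_right _ _).trans (min_le_left _ _), ?_⟩
  rintro P₀ ⟨T₀, hT₀, hP₀⟩ P₁ ⟨T₁, hT₁, hP₁⟩ hle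
  have hlec : patchDist P₀ P₁ ≤ c := hle.trans (min_le_left _ _)
  have hleρ : patchDist P₀ P₁ ≤ ρ / 4 :=
    hle.trans ((min_le_right _ _).trans (min_le_right _ _))
  obtain ⟨x, hx, hxP⟩ := hrig _ hlec T₁ hT₁ T₀ hT₀ P₁ hP₁.1 hP₁.2.1 hP₁.2.2.1 fun t ht => by
    obtain ⟨t₀, ht₀, h⟩ := exists_hausdorffDist_le_patchDist' hP₀.2.1 hP₁.2.1 hP₀.nonempty ht
    exact ⟨t₀, hP₀.1 ht₀, by rwa [hausdorffDist_comm]⟩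
  -- The tile of `P₀` close to `t₁` is close to `x +ᵥ t₁`, a tile of the same tiling.
  have key : ∀ t₁ ∈ P₁, ∀ t₀ ∈ P₀, hausdorffDist t₀ t₁ ≤ patchDist P₀ P₁ → t₀ = x +ᵥ t₁ := by
    intro t₁ ht₁ t₀ ht₀ h
    have h1 := (isTile_of_mem h𝒯 (hX hT₀) (hP₀.1 ht₀)).hausdorffDist_triangle
      (t₃ := x +ᵥ t₁) (isTile_of_mem h𝒯 (hX hT₁) (hP₁.1 ht₁))
    have h2 := hausdorffDist_vadd_le t₁ x
    rw [hausdorffDist_comm] at h2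
    exact eq_of_hausdorffDist_lt h𝒯 hρ hρ' (hX hT₀) (hP₀.1 ht₀) (hxP ⟨t₁, ht₁, rfl⟩)
      (by linarith)
  have heq : P₀ = x +ᵥ P₁ := by
    apply Subset.antisymm
    · intro t₀ ht₀
      obtain ⟨t₁, ht₁, h⟩ := exists_hausdorffDist_le_patchDist hP₀.2.1 hP₁.2.1 hP₁.nonempty ht₀
      exact ⟨t₁, ht₁, (key t₁ ht₁ t₀ ht₀ h).symm⟩
    · rintro _ ⟨t₁, ht₁, rfl⟩
      obtain ⟨t₀, ht₀, h⟩ := exists_hausdorffDist_le_patchDist' hP₀.2.1 hP₁.2.1 hP₀.nonempty ht₁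
      simp only
      rw [← key t₁ ht₁ t₀ ht₀ h]
      exact ht₀
  refine ⟨x, le_antisymm hx ?_, heq⟩
  conv_lhs => rw [heq]
  exact patchDist_vadd_le hP₁.nonempty x

/-! ### The strong distances -/

/-- A comparison of two distances follows from a comparison of the radii that define them. -/
theorem sInf_le_mul_sInf {A B : Set ℝ} {C : ℝ} (hC : 1 ≤ C) (hA : ∀ r ∈ A, 0 < r)
    (h : ∀ r ∈ B, C * r ≤ 1 → C * r ∈ A) : sInf ({1} ∪ A) ≤ C * sInf ({1} ∪ B) := by
  have hC0 : 0 < C := by linarith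
  have hbdd : BddBelow ({1} ∪ A) := by
    refine ⟨0, ?_⟩
    rintro r (rfl | hr)
    · exact zero_le_one
    · exact (hA r hr).le
  rw [← div_le_iff₀' hC0]
  refine le_csInf ⟨1, Or.inl rfl⟩ fun r hr => ?_
  rw [div_le_iff₀' hC0]
  have h1 : sInf ({1} ∪ A) ≤ 1 := csInf_le hbdd (Or.inl rfl)
  rcases hr with rfl | hr
  · linarith
  · rcases le_or_gt (C * r) 1 with hr1 | hr1
    · exact csInf_le hbdd (Or.inr (h r hr hr1))
    · linarith

theorem IsPatch.vadd (h : IsPatch T P) (x : Space d) : IsPatch (x +ᵥ T) (x +ᵥ P) := by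
  refine ⟨vadd_set_mono h.1, h.2.1.vadd_set, ?_, ?_⟩
  · rw [sUnion_vadd]
    exact h.2.2.1.image (fun y => x +ᵥ y) (by fun_prop)
  · rw [sUnion_vadd]
    intro y hy hb
    have hmem : -x +ᵥ y ∈ (⋃₀ P)ᶜ := fun hy' => hy ⟨_, hy', by simp⟩
    refine h.2.2.2 _ hmem ?_
    have hsub : x +ᵥ connectedComponentIn (⋃₀ P)ᶜ (-x +ᵥ y) ⊆
        connectedComponentIn (x +ᵥ ⋃₀ P)ᶜ y := by
      refine IsPreconnected.subset_connectedComponentIn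
        (isPreconnected_connectedComponentIn.image (fun y => x +ᵥ y) (by fun_prop))
        ⟨_, mem_connectedComponentIn hmem, by simp⟩ ?_
      rintro _ ⟨z, hz, rfl⟩ ⟨w, hw, hwz⟩
      have : w = z := by simpa using hwz
      exact connectedComponentIn_subset _ _ hz (this ▸ hw)
    have := (hb.subset hsub).vadd (-x)
    rwa [vadd_vadd, neg_add_cancel, zero_vadd] at this

theorem vadd_mem_coverPatches {a b : ℝ} {x : Space d} (h : P ∈ coverPatches T (cball a))
    (hab : b + ‖x‖ ≤ a) : x +ᵥ P ∈ coverPatches (x +ᵥ T) (cball b) := by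
  refine ⟨h.1.vadd x, fun y hy => ?_⟩
  rw [sUnion_vadd]
  refine ⟨-x + y, h.2 ?_, by simp⟩
  rw [mem_closedBall, dist_zero_right] at hy ⊢
  have := norm_add_le (-x) y
  rw [norm_neg] at this
  linarith

theorem coverPatches_anti {a b : ℝ} (h : P ∈ coverPatches T (cball a)) (hab : b ≤ a) :
    P ∈ coverPatches T (cball b) :=
  ⟨h.1, (closedBall_subset_closedBall hab).trans h.2⟩

theorem mem_coverPatches_of_subset {T' : Set (Set (Space d))} {K : Set (Space d)}
    (h : P ∈ coverPatches T K) (hP : P ⊆ T') : P ∈ coverPatches T' K :=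
  ⟨⟨hP, h.1.2⟩, h.2⟩

/-- Two tilings that share a patch covering a ball have the same smallest patch around it. -/
theorem minPatch_eq_of_mem_coverPatches (h𝒯 : IsTileset 𝒯)
    (hconn : ∀ p ∈ 𝒯, IsConnected (interior p)) {T₀ T₁ : Set (Set (Space d))}
    (hT₀ : T₀ ∈ fullShift 𝒯) (hT₁ : T₁ ∈ fullShift 𝒯) {r : ℝ} (hr : 0 < r)
    (h₀ : P ∈ coverPatches T₀ (cball r)) (h₁ : P ∈ coverPatches T₁ (cball r)) :
    minPatch T₀ (cball r) = minPatch T₁ (cball r) := by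
  obtain ⟨M, hM0, hM⟩ := h𝒯.exists_bound
  have key : ∀ T₀ ∈ fullShift 𝒯, ∀ T₁ : Set (Set (Space d)), P ∈ coverPatches T₀ (cball r) →
      P ∈ coverPatches T₁ (cball r) → minPatch T₁ (cball r) ⊆ minPatch T₀ (cball r) :=
    fun T₀ hT₀ T₁ h₀ h₁ => sInter_subset_of_mem (mem_coverPatches_of_subset
      (minPatch_mem_coverPatches h𝒯 hconn hM0 hM hT₀ hr).1
      ((sInter_subset_of_mem h₀).trans h₁.1.1))
  exact (key T₁ hT₁ T₀ h₁ h₀).antisymm (key T₀ hT₀ T₁ h₀ h₁)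

theorem one_div_two_mul_add_le {r : ℝ} (hr : 0 < r) (h : 2 * r ≤ 1) :
    1 / (2 * r) + r ≤ 1 / r := by
  have h1 : 1 / r = 1 / (2 * r) + 1 / (2 * r) := by field_simp; norm_num
  have h2 : 1 ≤ 1 / (2 * r) := by rwa [le_div_iff₀ (by positivity), one_mul]
  linarith

theorem ds1_le_two_mul_ds2 (h𝒯 : IsTileset 𝒯) (hconn : ∀ p ∈ 𝒯, IsConnected (interior p))
    {T₀ T₁ : Set (Set (Space d))} (hT₀ : T₀ ∈ fullShift 𝒯) (hT₁ : T₁ ∈ fullShift 𝒯) :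
    ds1 T₀ T₁ ≤ 2 * ds2 T₀ T₁ := by
  obtain ⟨M, hM0, hM⟩ := h𝒯.exists_bound
  refine sInf_le_mul_sInf one_le_two (fun r hr => hr.1) ?_
  rintro r ⟨hr, x₀, hx₀, x₁, hx₁, heq⟩ hr1
  rw [mem_closedBall, dist_zero_right] at hx₀ hx₁
  have h := one_div_two_mul_add_le hr hr1
  have h₀ := (minPatch_mem_coverPatches h𝒯 hconn hM0 hM (vadd_mem_fullShift hT₀ x₀)
    (one_div_pos.2 hr)).1
  have h₁ := (minPatch_mem_coverPatches h𝒯 hconn hM0 hM (vadd_mem_fullShift hT₁ x₁)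
    (one_div_pos.2 hr)).1
  rw [← heq] at h₁
  have h₀' := vadd_mem_coverPatches (x := -x₀) (b := 1 / (2 * r)) h₀
    (by rw [norm_neg]; linarith)
  have h₁' := vadd_mem_coverPatches (x := -x₁) (b := 1 / (2 * r)) h₁
    (by rw [norm_neg]; linarith)
  rw [vadd_vadd, neg_add_cancel, zero_vadd] at h₀' h₁'
  refine ⟨by positivity, x₁ - x₀, ?_, _, h₀', _, h₁', ?_⟩
  · rw [mem_closedBall, dist_zero_right]
    linarith [norm_sub_le x₁ x₀]
  · rw [vadd_vadd]
    congr 1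
    abel

theorem ds2_le_two_mul_ds1 (h𝒯 : IsTileset 𝒯) (hconn : ∀ p ∈ 𝒯, IsConnected (interior p))
    {T₀ T₁ : Set (Set (Space d))} (hT₀ : T₀ ∈ fullShift 𝒯) (hT₁ : T₁ ∈ fullShift 𝒯) :
    ds2 T₀ T₁ ≤ 2 * ds1 T₀ T₁ := by
  refine sInf_le_mul_sInf one_le_two (fun r hr => hr.1) ?_
  rintro r ⟨hr, x, hx, P₀, hP₀, P₁, hP₁, rfl⟩ hr1
  rw [mem_closedBall, dist_zero_right] at hx
  have h := one_div_two_mul_add_le hr hr1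
  refine ⟨by positivity, 0, by simp [hr.le], x, by
    rw [mem_closedBall, dist_zero_right]; linarith, ?_⟩
  rw [zero_vadd]
  exact minPatch_eq_of_mem_coverPatches h𝒯 hconn hT₀ (vadd_mem_fullShift hT₁ x) (by positivity)
    (coverPatches_anti hP₀ (by linarith)) (vadd_mem_coverPatches hP₁ (by linarith))

/-! ### The weak distances -/

theorem dw1_le_ds1 (T₀ T₁ : Set (Set (Space d))) : dw1 T₀ T₁ ≤ 1 * ds1 T₀ T₁ := by
  refine sInf_le_mul_sInf le_rfl (fun r hr => hr.1) ?_
  rintro r ⟨hr, x, hx, P₀, hP₀, P₁, hP₁, rfl⟩ -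
  rw [one_mul]
  rw [mem_closedBall, dist_zero_right] at hx
  exact ⟨hr, _, hP₀, _, hP₁, (patchDist_vadd_le hP₁.1.nonempty x).trans hx⟩

theorem ds1_le_mul_dw1 {c : ℝ} (hc : 0 < c) (hc1 : c ≤ 1)
    (h : ∀ P₀ ∈ patchesOf X, ∀ P₁ ∈ patchesOf X, patchDist P₀ P₁ ≤ c →
      ∃ x : Space d, ‖x‖ = patchDist P₀ P₁ ∧ P₀ = x +ᵥ P₁)
    {T₀ T₁ : Set (Set (Space d))} (hT₀ : T₀ ∈ X) (hT₁ : T₁ ∈ X) :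
    ds1 T₀ T₁ ≤ (1 / c) * dw1 T₀ T₁ := by
  have hC : 1 ≤ 1 / c := by rwa [le_div_iff₀ hc, one_mul]
  refine sInf_le_mul_sInf hC (fun r hr => hr.1) ?_
  rintro r ⟨hr, P₀, hP₀, P₁, hP₁, hle⟩ hr1
  have hrc : r ≤ c := by
    rw [one_div_mul_eq_div, div_le_iff₀ hc, one_mul] at hr1
    exact hr1
  have hrr : r ≤ 1 / c * r := le_mul_of_one_le_left hr.le hC
  have hrr' : 1 / (1 / c * r) ≤ 1 / r := one_div_le_one_div_of_le hr hrr
  obtain ⟨x, hx, hP⟩ := h P₀ ⟨T₀, hT₀, hP₀.1⟩ P₁ ⟨T₁, hT₁, hP₁.1⟩ (hle.trans hrc)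
  exact ⟨by positivity, x, by rw [mem_closedBall, dist_zero_right]; linarith, P₀,
    coverPatches_anti hP₀ hrr', P₁, coverPatches_anti hP₁ hrr', hP⟩

/-- If the patch `P` of `T₀` covers a ball and a translate of `P` appears in `T₁`, then each point
of the boundary of `T₀` in a smaller ball is close to one of `T₁`: the translated point, or a point
of the sphere that lies between the two. -/
theorem exists_rBoundary_dist_le (h𝒯 : IsTileset 𝒯) {T₀ T₁ : Set (Set (Space d))}
    (hT₀ : T₀ ∈ fullShift 𝒯) {R R' s : ℝ} (hR : R < R')
    (hP : P ∈ coverPatches T₀ (cball R')) {x : Space d} (hx : ‖x‖ ≤ s) (hxP : x +ᵥ P ⊆ T₁) :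
    ∀ a ∈ rBoundary R T₀, ∃ b ∈ rBoundary R T₁, dist a b ≤ s := by
  have hs : 0 ≤ s := (norm_nonneg x).trans hx
  rintro a (ha | ⟨haR, ha⟩)
  · exact ⟨a, Or.inl ha, by simpa using hs⟩
  simp only [mem_iUnion] at ha
  obtain ⟨t, ht, hat⟩ := ha
  rw [mem_closedBall, dist_zero_right] at haR
  have htP : t ∈ P := mem_of_inter_ball_nonempty h𝒯 hT₀ hP.1.1
    (ball_subset_closedBall.trans hP.2) ht
    ⟨a, (isTile_of_mem h𝒯 hT₀ ht).isClosed.frontier_subset hat, by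
      rw [mem_ball, dist_zero_right]; linarith⟩
  rcases le_or_gt ‖x + a‖ R with hle | hlt
  · refine ⟨x + a, Or.inr ⟨by rwa [mem_closedBall, dist_zero_right], ?_⟩, ?_⟩
    · refine mem_biUnion (hxP ⟨t, htP, rfl⟩) ?_
      have : frontier (x +ᵥ t) = x +ᵥ frontier t :=
        ((Homeomorph.vadd x).image_frontier t).symm
      simp only [this]
      exact ⟨a, hat, rfl⟩
    · simpa [dist_eq_norm] using hx
  · obtain ⟨l, ⟨hl0, hl1⟩, hl⟩ := intermediate_value_Icc (zero_le_one' ℝ)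
      (f := fun l : ℝ => ‖l • x + a‖) (by fun_prop) (show R ∈ _ from ⟨by simpa using haR, by
        simpa using hlt.le⟩)
    refine ⟨l • x + a, Or.inl (by simpa using hl), ?_⟩
    have : dist a (l • x + a) = l * ‖x‖ := by
      simp [dist_eq_norm, norm_smul, abs_of_nonneg hl0]
    rw [this]
    nlinarith [norm_nonneg x]

theorem dw2_le_two_mul_ds1 (h𝒯 : IsTileset 𝒯)
    {T₀ T₁ : Set (Set (Space d))} (hT₀ : T₀ ∈ fullShift 𝒯) (hT₁ : T₁ ∈ fullShift 𝒯) :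
    dw2 T₀ T₁ ≤ 2 * ds1 T₀ T₁ := by
  refine sInf_le_mul_sInf one_le_two (fun r hr => hr.1) ?_
  rintro r ⟨hr, x, hx, P₀, hP₀, P₁, hP₁, rfl⟩ hr1
  rw [mem_closedBall, dist_zero_right] at hx
  have h := one_div_two_mul_add_le hr hr1
  refine ⟨by positivity, hausdorffDist_le_of_mem_dist (by positivity) ?_ ?_⟩
  · refine exists_rBoundary_dist_le h𝒯 hT₀ (R' := 1 / r) (by linarith) hP₀ (x := -x)
      (by rw [norm_neg]; linarith) ?_
    rw [vadd_vadd, neg_add_cancel, zero_vadd]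
    exact hP₁.1.1
  · exact exists_rBoundary_dist_le h𝒯 hT₁ (R' := 1 / r) (by linarith) hP₁ (x := x)
      (by linarith) hP₀.1.1

/-! ### From close boundaries to close tiles -/

/-- A tile with connected interior has a connected subset that is nearly dense in the tile and
stays away from its boundary: join finitely many interior points by paths. -/
theorem IsTile.exists_skeleton (ht : IsTile t) (hconn : IsConnected (interior t)) {ε : ℝ}
    (hε : 0 < ε) : ∃ η > 0, ∃ K : Set (Space d), IsConnected K ∧
      (∀ y ∈ t, ∃ k ∈ K, dist y k ≤ ε) ∧ ∀ k ∈ K, ball k η ⊆ interior t := by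
  obtain ⟨F, hFt, hF, hcov⟩ := finite_cover_balls_of_compact ht.2.1 (half_pos hε)
  have hq : ∀ y ∈ F, ∃ q ∈ interior t, dist y q < ε / 2 := fun y hy => by
    have : y ∈ closure (interior t) := by rw [ht.2.2]; exact hFt hy
    exact Metric.mem_closure_iff.1 this _ (half_pos hε)
  choose! q hqt hq using hq
  have hpath := isOpen_interior.isConnected_iff_isPathConnected.1 hconn
  obtain ⟨x₀, hx₀, hjoin⟩ := hpath
  have hA : ∀ y ∈ F, ∃ A : Set (Space d), IsCompact A ∧ IsPreconnected A ∧ x₀ ∈ A ∧ q y ∈ A ∧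
      A ⊆ interior t := fun y hy => by
    have hj := hjoin (hqt y hy)
    refine ⟨range hj.somePath, isCompact_range hj.somePath.continuous,
      isPreconnected_range hj.somePath.continuous, ⟨0, hj.somePath.source⟩,
      ⟨1, hj.somePath.target⟩, ?_⟩
    rintro _ ⟨s, rfl⟩
    exact hj.somePath_mem s
  choose! A hAc hAp hAx hAq hAt using hA
  have hKt : insert x₀ (⋃ y ∈ F, A y) ⊆ interior t := insert_subset hx₀ (iUnion₂_subset hAt)
  have hKc : IsCompact (insert x₀ (⋃ y ∈ F, A y)) := (hF.isCompact_biUnion hAc).insert x₀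
  obtain ⟨η, hη, hηK⟩ := hKc.exists_thickening_subset_open isOpen_interior hKt
  refine ⟨η, hη, insert x₀ (⋃ y ∈ F, A y),
    ⟨⟨x₀, mem_insert _ _⟩, isPreconnected_of_forall x₀ ?_⟩, ?_, ?_⟩
  · rintro y (rfl | hy)
    · exact ⟨{y}, by simp, by simp, by simp, isPreconnected_singleton⟩
    · simp only [mem_iUnion] at hy
      obtain ⟨z, hz, hyz⟩ := hy
      exact ⟨A z, (subset_biUnion_of_mem (u := A) hz).trans (subset_insert _ _), hAx z hz, hyz,
        hAp z hz⟩
  · intro y hy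
    have := hcov hy
    simp only [mem_iUnion] at this
    obtain ⟨z, hz, hyz⟩ := this
    refine ⟨q z, mem_insert_of_mem _ (mem_biUnion hz (hAq z hz)), ?_⟩
    rw [mem_ball] at hyz
    linarith [dist_triangle y z (q z), hq z hz]
  · exact fun k hk => (ball_subset_thickening hk η).trans hηK

/-- Skeletons with a common distance to the boundary, for all tiles of all tilings. -/
theorem exists_skeletons (h𝒯 : IsTileset 𝒯) (hconn : ∀ p ∈ 𝒯, IsConnected (interior p)) {ε : ℝ}
    (hε : 0 < ε) : ∃ η > 0, ∀ T ∈ fullShift 𝒯, ∀ t ∈ T, ∃ K : Set (Space d), IsConnected K ∧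
      (∀ y ∈ t, ∃ k ∈ K, dist y k ≤ ε) ∧ ∀ k ∈ K, ball k η ⊆ interior t := by
  obtain ⟨η, hη, h⟩ := exists_pos_forall_of_finite h𝒯.1
    (Q := fun p η => ∃ K : Set (Space d), IsConnected K ∧
      (∀ y ∈ p, ∃ k ∈ K, dist y k ≤ ε) ∧ ∀ k ∈ K, ball k η ⊆ interior p)
    (fun p a b hab ⟨K, h1, h2, h3⟩ =>
      ⟨K, h1, h2, fun k hk => (ball_subset_ball hab).trans (h3 k hk)⟩)
    (fun p hp => (h𝒯.2 p hp).exists_skeleton (hconn p hp) hε)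
  refine ⟨η, hη, fun T hT t ht => ?_⟩
  obtain ⟨p, hp, x, rfl⟩ := hT.1 t ht
  obtain ⟨K, h1, h2, h3⟩ := h p hp
  refine ⟨x +ᵥ K, h1.image (fun y => x +ᵥ y) (by fun_prop), ?_, ?_⟩
  · rintro _ ⟨y, hy, rfl⟩
    obtain ⟨k, hk, hyk⟩ := h2 y hy
    exact ⟨x + k, ⟨k, hk, rfl⟩, by simpa [dist_eq_norm] using hyk⟩
  · rintro _ ⟨k, hk, rfl⟩ y hy
    rw [interior_vadd]
    refine ⟨-x + y, h3 k hk ?_, by simp⟩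
    rw [mem_ball, dist_eq_norm] at hy ⊢
    convert hy using 2
    simp only [vadd_eq_add]
    abel

/-- If near a tile `t` of `T₀` the boundary of `T₁` is close to that of `T₀`, then some tile of
`T₁` comes close to every point of `t`: the skeleton of `t` avoids the boundary of `T₁`, so by
connectedness it lies in a single tile. -/
theorem exists_tile_nearly_covering (h𝒯 : IsTileset 𝒯) {T₀ T₁ : Set (Set (Space d))}
    (hT₀ : T₀ ∈ fullShift 𝒯) (hT₁ : T₁ ∈ fullShift 𝒯) {ε η R s : ℝ}
    (hskel : ∀ t ∈ T₀, ∃ K : Set (Space d), IsConnected K ∧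
      (∀ y ∈ t, ∃ k ∈ K, dist y k ≤ ε) ∧ ∀ k ∈ K, ball k η ⊆ interior t)
    (hη : 0 < η) (hsη : s ≤ η) (hs1 : s ≤ 1)
    (hb : ∀ b ∈ rBoundary R T₁, ∃ a ∈ rBoundary R T₀, dist b a < s)
    (ht : t ∈ T₀) (htR : t ⊆ closedBall 0 (R - 1)) :
    ∃ t₁ ∈ T₁, ∀ y ∈ t, ∃ z ∈ t₁, dist y z ≤ ε := by
  obtain ⟨K, hK, hKt, hKη⟩ := hskel t ht
  have hKR : ∀ k ∈ K, ‖k‖ ≤ R - 1 := fun k hk => by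
    simpa using htR (interior_subset (hKη k hk (mem_ball_self hη)))
  have havoid : ∀ k ∈ K, ∀ t₁ ∈ T₁, k ∉ frontier t₁ := by
    intro k hk t₁ ht₁ hkt
    obtain ⟨a, ha, hka⟩ := hb k (Or.inr ⟨by
      rw [mem_closedBall, dist_zero_right]; linarith [hKR k hk], mem_biUnion ht₁ hkt⟩)
    rcases ha with ha | ⟨-, ha⟩
    · rw [mem_sphere, dist_zero_right] at ha
      rw [dist_comm, dist_eq_norm] at hka
      linarith [norm_sub_norm_le a k, hKR k hk]
    · simp only [mem_iUnion] at ha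
      obtain ⟨t₂, ht₂, ha⟩ := ha
      have hai : a ∈ interior t := hKη k hk (by rw [mem_ball']; linarith)
      have := eq_of_mem_interior h𝒯 hT₀ ht ht₂ hai
        ((isTile_of_mem h𝒯 hT₀ ht₂).isClosed.frontier_subset ha)
      rw [← this] at ha
      exact ha.2 hai
  obtain ⟨k₀, hk₀⟩ := hK.1
  obtain ⟨t₁, ht₁, hk₀t⟩ := exists_mem_tile hT₁ k₀
  have hcl := (isTile_of_mem h𝒯 hT₁ ht₁).isClosed
  have hint : ∀ k ∈ K, k ∈ t₁ → k ∈ interior t₁ := fun k hk hkt => by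
    by_contra h
    exact havoid k hk t₁ ht₁ ⟨subset_closure hkt, h⟩
  have hsub : K ⊆ interior t₁ := by
    refine hK.2.subset_left_of_subset_union isOpen_interior hcl.isOpen_compl
      (disjoint_left.2 fun z hz hz' => hz' (interior_subset hz)) (fun k hk => ?_)
      ⟨k₀, hk₀, hint k₀ hk₀ hk₀t⟩
    by_cases h : k ∈ t₁
    · exact Or.inl (hint k hk h)
    · exact Or.inr h
  refine ⟨t₁, ht₁, fun y hy => ?_⟩
  obtain ⟨k, hk, hyk⟩ := hKt y hy
  exact ⟨k, interior_subset (hsub hk), hyk⟩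

/-- If the boundaries of two tilings are close in a ball, then each tile of one that lies deep
inside the ball is close to a tile of the other. -/
theorem exists_hausdorffDist_le_of_rBoundary (h𝒯 : IsTileset 𝒯) {T₀ T₁ : Set (Set (Space d))}
    (hT₀ : T₀ ∈ fullShift 𝒯) (hT₁ : T₁ ∈ fullShift 𝒯) {M ρ ε η R s : ℝ}
    (hM : ∀ p ∈ 𝒯, p ⊆ closedBall 0 M) (hρ0 : 0 < ρ) (hρ : ∀ p ∈ 𝒯, ∃ z, ball z ρ ⊆ p)
    (hε0 : 0 < ε) (hε1 : ε ≤ 1) (hερ : 2 * ε < ρ)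
    (hskel : ∀ T ∈ fullShift 𝒯, ∀ t ∈ T, ∃ K : Set (Space d), IsConnected K ∧
      (∀ y ∈ t, ∃ k ∈ K, dist y k ≤ ε) ∧ ∀ k ∈ K, ball k η ⊆ interior t)
    (hη : 0 < η) (hsη : s ≤ η) (hs1 : s ≤ 1)
    (hb₀ : ∀ a ∈ rBoundary R T₀, ∃ b ∈ rBoundary R T₁, dist a b < s)
    (hb₁ : ∀ b ∈ rBoundary R T₁, ∃ a ∈ rBoundary R T₀, dist b a < s)
    (ht : t ∈ T₀) (htR : t ⊆ closedBall 0 (R - 2 - 2 * M)) :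
    ∃ t₁ ∈ T₁, hausdorffDist t t₁ ≤ ε := by
  obtain ⟨z, hz⟩ := exists_ball_subset_tile hρ hT₀ ht
  have hzt : z ∈ t := interior_subset (hz (mem_ball_self hρ0))
  have hM0 : 0 ≤ 2 * M := by simpa using dist_le_of_mem_tile hM hT₀ ht hzt hzt
  obtain ⟨t₁, ht₁, h₁⟩ := exists_tile_nearly_covering h𝒯 hT₀ hT₁ (hskel T₀ hT₀) hη hsη hs1 hb₁ ht
    (htR.trans (closedBall_subset_closedBall (by linarith)))
  obtain ⟨w, hw, hzw⟩ := h₁ z hzt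
  have ht₁R : t₁ ⊆ closedBall 0 (R - 1) := by
    intro y hy
    have h2 := htR hzt
    rw [mem_closedBall] at h2 ⊢
    have h3 := dist_le_of_mem_tile hM hT₁ ht₁ hy hw
    rw [dist_comm] at hzw
    linarith [dist_triangle y w 0, dist_triangle w z 0]
  obtain ⟨t₂, ht₂, h₂⟩ := exists_tile_nearly_covering h𝒯 hT₁ hT₀ (hskel T₁ hT₁) hη hsη hs1 hb₀
    ht₁ ht₁R
  obtain ⟨u, hu, hwu⟩ := h₂ w hw
  have : t = t₂ := by
    refine eq_of_mem_interior h𝒯 hT₀ ht ht₂ (z := u) (hz ?_) hu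
    rw [mem_ball']
    linarith [dist_triangle z w u]
  rw [← this] at h₂
  exact ⟨t₁, ht₁, hausdorffDist_le_of_mem_dist hε0.le h₁ h₂⟩

/-! ### Almost periods of the boundary -/

/-- Let `G` be a set that avoids the ball of radius `ρ` around `z` and is, near `z`, carried into
the `s`-neighbourhood of itself by the translation by a short vector `w`. If `G` contains a point
straight behind `z`, then `w` is at most a multiple of `s`: iterating the translation leads from
this point into the ball, unless the accumulated error is at least of the order of `ρ`. -/
theorem norm_mul_le_of_almost_period {G : Set (Space d)} {z w : Space d} {ρ s L a : ℝ}
    (hs : 0 ≤ s) (hρ : ∀ y ∈ G, ρ ≤ ‖y - z‖) (hw : ‖w‖ ≤ ρ / 2)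
    (step : ∀ y ∈ G, ‖y - z‖ ≤ L + ρ → ∃ y' ∈ G, ‖y' - (y + w)‖ ≤ s)
    (ha : 0 ≤ a) (h0 : z - a • w ∈ G) (haL : a * ‖w‖ ≤ L) : ‖w‖ * ρ ≤ 2 * L * s := by
  by_contra! hlt
  have hL : 0 ≤ L := le_trans (by positivity) haL
  have hw0 : 0 < ‖w‖ := by
    rcases (norm_nonneg w).eq_or_lt with h | h
    · rw [← h, zero_mul] at hlt
      exact absurd hlt (not_lt.2 (by positivity))
    · exact h
  -- The point `z - a • w` is about `a` steps behind `z`, so this bounds the total error.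
  have has : a * s < ρ / 2 := by
    have h1 : a * ‖w‖ * s ≤ L * s := mul_le_mul_of_nonneg_right haL hs
    have h2 : ‖w‖ * (a * s) < ‖w‖ * (ρ / 2) := by nlinarith
    exact lt_of_mul_lt_mul_left h2 hw0.le
  have hnear : ∀ (b e : ℝ) (y : Space d), 0 ≤ b → ‖y - (z - b • w)‖ ≤ e →
      ‖y - z‖ ≤ e + b * ‖w‖ := fun b e y hb hy => by
    have h1 : y - z = (y - (z - b • w)) - b • w := by abel
    have h2 := norm_sub_le (y - (z - b • w)) (b • w)
    rw [← h1, norm_smul, Real.norm_eq_abs, abs_of_nonneg hb] at h2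
    linarith
  have key : ∀ n : ℕ, (n : ℝ) ≤ a → ∃ y ∈ G, ‖y - (z - (a - n) • w)‖ ≤ n * s := by
    intro n
    induction n with
    | zero => exact fun _ => ⟨_, h0, by simp⟩
    | succ n ih =>
      intro hn
      push_cast at hn ⊢
      obtain ⟨y, hy, hyn⟩ := ih (by linarith)
      have h1 := hnear (a - n) _ y (by linarith) hyn
      have h2 : (n : ℝ) * s ≤ a * s := mul_le_mul_of_nonneg_right (by linarith) hs
      have h3 : (a - n) * ‖w‖ ≤ a * ‖w‖ :=
        mul_le_mul_of_nonneg_right (by linarith [(Nat.cast_nonneg n : (0 : ℝ) ≤ n)]) hw0.le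
      obtain ⟨y', hy', hyy'⟩ := step y hy (by linarith)
      refine ⟨y', hy', ?_⟩
      have h4 : y' - (z - (a - (n + 1)) • w) = (y' - (y + w)) + (y - (z - (a - n) • w)) := by
        module
      rw [h4]
      linarith [norm_add_le (y' - (y + w)) (y - (z - (a - n) • w))]
  obtain ⟨y, hy, hyn⟩ := key ⌊a⌋₊ (Nat.floor_le ha)
  have h1 := hnear _ _ y (sub_nonneg.2 (Nat.floor_le ha)) hyn
  have h2 : (⌊a⌋₊ : ℝ) * s ≤ a * s := mul_le_mul_of_nonneg_right (Nat.floor_le ha) hs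
  have h3 : (a - ⌊a⌋₊) * ‖w‖ ≤ 1 * ‖w‖ :=
    mul_le_mul_of_nonneg_right (by linarith [Nat.lt_floor_add_one a]) hw0.le
  linarith [hρ y hy]

/-- Every ray that starts at an interior point of a tile meets the boundary of the tile. -/
theorem IsTile.exists_smul_mem_frontier (ht : IsTile t) {z w : Space d} (hz : z ∈ interior t)
    (hw : w ≠ 0) : ∃ a : ℝ, 0 ≤ a ∧ z - a • w ∈ frontier t := by
  by_contra! hne
  have hpre : IsPreconnected ((fun a : ℝ => z - a • w) '' Ici 0) :=
    isPreconnected_Ici.image _ (by fun_prop)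
  have hsub : (fun a : ℝ => z - a • w) '' Ici 0 ⊆ interior t := by
    refine hpre.subset_left_of_subset_union isOpen_interior ht.isClosed.isOpen_compl
      (disjoint_left.2 fun z hz hz' => hz' (interior_subset hz)) ?_ ⟨z, ⟨0, by simp, by simp⟩, hz⟩
    rintro _ ⟨a, ha, rfl⟩
    by_cases h : z - a • w ∈ t
    · left
      by_contra h'
      exact hne a ha ⟨subset_closure h, h'⟩
    · exact Or.inr h
  obtain ⟨C, hC⟩ := ht.2.1.isBounded.subset_closedBall z
  have hw0 := norm_pos_iff.2 hw
  have h := hC (interior_subset (hsub ⟨(|C| + 1) / ‖w‖, mem_Ici.2 (by positivity), rfl⟩))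
  rw [mem_closedBall, dist_eq_norm, sub_sub_cancel_left, norm_neg, norm_smul, Real.norm_eq_abs,
    abs_of_nonneg (by positivity), div_mul_cancel₀ _ hw0.ne'] at h
  linarith [le_abs_self C]

/-- If two tilings agree, up to the translation by a short vector `x`, on a large ball, and their
boundaries are at distance at most `s`, then `x` is at most a multiple of `s`. -/
theorem norm_mul_le_of_rBoundary (h𝒯 : IsTileset 𝒯) {T₀ T₁ : Set (Set (Space d))}
    (hT₀ : T₀ ∈ fullShift 𝒯) (hT₁ : T₁ ∈ fullShift 𝒯) {M ρ R R' s : ℝ}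
    (hM : ∀ p ∈ 𝒯, p ⊆ closedBall 0 M) (hρ0 : 0 < ρ) (hρ : ∀ p ∈ 𝒯, ∃ z, ball z ρ ⊆ p)
    (hs0 : 0 ≤ s) (hs1 : s ≤ 1) (hRR' : R' ≤ R) (hR' : 4 * M + ρ + 1 < R')
    (hb : ∀ a ∈ rBoundary R T₀, ∃ b ∈ rBoundary R T₁, dist a b < s)
    {x : Space d} (hx : ‖x‖ ≤ ρ / 2) (hP : P ⊆ T₀)
    (hxP : x +ᵥ P ∈ coverPatches T₁ (cball R')) : ‖x‖ * ρ ≤ 2 * (2 * M) * s := by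
  obtain ⟨t, ht, h0t⟩ := exists_mem_tile hT₀ 0
  obtain ⟨z, hz⟩ := exists_ball_subset_tile hρ hT₀ ht
  have hzi := hz (mem_ball_self hρ0)
  have hzM : ‖z‖ ≤ 2 * M := by
    simpa using dist_le_of_mem_tile hM hT₀ ht (interior_subset hzi) h0t
  rcases eq_or_ne x 0 with rfl | hx0
  · rw [norm_zero, zero_mul]
    exact mul_nonneg (by linarith [norm_nonneg z]) hs0
  have hti := isTile_of_mem h𝒯 hT₀ ht
  obtain ⟨a, ha, haf⟩ := hti.exists_smul_mem_frontier hzi (neg_ne_zero.2 hx0)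
  have haL := dist_le_of_mem_tile hM hT₀ ht (interior_subset hzi) (hti.isClosed.frontier_subset haf)
  rw [dist_eq_norm, sub_sub_cancel, norm_smul, Real.norm_eq_abs, abs_of_nonneg ha] at haL
  rw [← norm_neg x]
  rw [← norm_neg x] at hx
  refine norm_mul_le_of_almost_period (G := ⋃ t ∈ T₀, frontier t) hs0 ?_ hx ?_ ha
    (mem_biUnion ht haf) haL
  · intro y hy
    simp only [mem_iUnion] at hy
    obtain ⟨t', ht', hy⟩ := hy
    by_contra! hlt
    have hyi : y ∈ interior t := hz (by rwa [mem_ball, dist_eq_norm])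
    have := eq_of_mem_interior h𝒯 hT₀ ht ht' hyi
      ((isTile_of_mem h𝒯 hT₀ ht').isClosed.frontier_subset hy)
    rw [← this] at hy
    exact hy.2 hyi
  · intro y hy hyz
    have hyM : ‖y‖ ≤ 4 * M + ρ := by
      have := norm_sub_norm_le y z
      linarith
    obtain ⟨b, hb, hyb⟩ := hb y (Or.inr ⟨by
      rw [mem_closedBall, dist_zero_right]; linarith, hy⟩)
    rw [dist_comm, dist_eq_norm] at hyb
    have hbR : ‖b‖ < R' := by
      have := norm_sub_norm_le b y
      linarith
    rcases hb with hb | ⟨-, hb⟩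
    · rw [mem_sphere, dist_zero_right] at hb
      linarith
    simp only [mem_iUnion] at hb
    obtain ⟨t₁, ht₁, hbt⟩ := hb
    have ht₁P := mem_of_inter_ball_nonempty h𝒯 hT₁ hxP.1.1
      (ball_subset_closedBall.trans hxP.2) ht₁
      ⟨b, (isTile_of_mem h𝒯 hT₁ ht₁).isClosed.frontier_subset hbt, by simpa using hbR⟩
    obtain ⟨t₂, ht₂, rfl⟩ := ht₁P
    have hfr : frontier (x +ᵥ t₂) = x +ᵥ frontier t₂ :=
      ((Homeomorph.vadd x).image_frontier t₂).symm
    simp only [hfr] at hbt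
    obtain ⟨y', hy', rfl⟩ := hbt
    refine ⟨y', mem_biUnion (hP ht₂) hy', ?_⟩
    have : y' - (y + -x) = (fun y => x +ᵥ y) y' - y := by simp only [vadd_eq_add]; abel
    rw [this]
    exact hyb.le

theorem exists_dist_lt_of_rBoundary (hd : 0 < d) {T₀ T₁ : Set (Set (Space d))} {R r s : ℝ}
    (hR : 0 ≤ R) (h : hausdorffDist (rBoundary R T₀) (rBoundary R T₁) ≤ r) (hrs : r < s) :
    ∀ a ∈ rBoundary R T₀, ∃ b ∈ rBoundary R T₁, dist a b < s := by
  have : NeZero d := ⟨hd.ne'⟩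
  have hne : ∀ T : Set (Set (Space d)), (rBoundary R T).Nonempty := fun T =>
    (NormedSpace.sphere_nonempty.2 hR).mono subset_union_left
  have hbd : ∀ T : Set (Set (Space d)), Bornology.IsBounded (rBoundary R T) := fun T =>
    isBounded_closedBall.subset (union_subset sphere_subset_closedBall inter_subset_left)
  exact fun a ha => exists_dist_lt_of_hausdorffDist_lt ha (h.trans_lt hrs)
    (hausdorffEDist_ne_top_of_nonempty_of_bounded (hne _) (hne _) (hbd _) (hbd _))

/-- The first strong distance is dominated by the second weak one: by rigidity, tilings with close
boundaries agree on a large ball up to a short translation, whose length is controlled by the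
distance of the boundaries. -/
theorem exists_ds1_le_mul_dw2 (hd : 0 < d) (h𝒯 : IsTileset 𝒯)
    (hconn : ∀ p ∈ 𝒯, IsConnected (interior p)) (hX : X ⊆ fullShift 𝒯)
    (hinv : ∀ T ∈ X, ∀ x : Space d, x +ᵥ T ∈ X) (hFLC : FLC X) :
    ∃ C > 0, ∀ T₀ ∈ X, ∀ T₁ ∈ X, ds1 T₀ T₁ ≤ C * dw2 T₀ T₁ := by
  obtain ⟨c, hc, hrig⟩ := exists_rigidity_constant h𝒯 hconn hX hinv hFLC
  obtain ⟨M, hM0, hM⟩ := h𝒯.exists_bound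
  obtain ⟨ρ, hρ0, hρ⟩ := h𝒯.exists_inradius
  set ε := min c (min 1 (ρ / 4)) with hε
  have hε0 : 0 < ε := by positivity
  have hεc : ε ≤ c := min_le_left _ _
  have hε1 : ε ≤ 1 := (min_le_right _ _).trans (min_le_left _ _)
  have hερ : ε ≤ ρ / 4 := (min_le_right _ _).trans (min_le_right _ _)
  obtain ⟨η, hη, hskel⟩ := exists_skeletons h𝒯 hconn hε0
  -- With `C * r ≤ 1`, the first term makes `2 * r ≤ η`, the second bounds the translation by
  -- `C * r`, and the third leaves room for a patch around the ball of radius `1 / (C * r)`.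
  set C := 2 / η + 8 * M / ρ + (16 * M + 2 * ρ + 20) with hC
  have hC1 : 2 / η ≤ C := by rw [hC]; linarith [show 0 ≤ 8 * M / ρ by positivity]
  have hC2 : 8 * M / ρ ≤ C := by rw [hC]; linarith [show 0 ≤ 2 / η by positivity]
  have hC3 : 16 * M + 2 * ρ + 20 ≤ C := by
    have : 0 ≤ 2 / η + 8 * M / ρ := by positivity
    rw [hC]; linarith
  have hC0 : 0 < C := by linarith
  refine ⟨C, hC0, fun T₀ hT₀ T₁ hT₁ => sInf_le_mul_sInf (by linarith) (fun r hr => hr.1) ?_⟩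
  rintro r ⟨hr, hdist⟩ hCr
  set R := 1 / r with hR
  have hCR : C ≤ R := by rwa [hR, le_div_iff₀ hr]
  have hR0 : 0 < R := by positivity
  have hb₀ := exists_dist_lt_of_rBoundary hd hR0.le hdist (show r < 2 * r by linarith)
  have hb₁ := exists_dist_lt_of_rBoundary hd hR0.le (by rwa [hausdorffDist_comm])
    (show r < 2 * r by linarith)
  have hrη : 2 * r ≤ η := by
    have := (div_le_iff₀ hη).1 (hC1.trans hCR)
    rw [hR, one_div_mul_eq_div, le_div_iff₀ hr] at this
    exact this
  have hr1 : 2 * r ≤ 1 := by nlinarith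
  set R' := R - 4 * M - 4 with hR'
  obtain ⟨hPc, hPsupp⟩ := minPatch_mem_coverPatches h𝒯 hconn hM0 hM (hX hT₀)
    (r := R') (by linarith)
  set P := minPatch T₀ (cball R') with hP
  obtain ⟨x, hxε, hxP⟩ := hrig ε hεc T₀ hT₀ T₁ hT₁ P hPc.1.1 hPc.1.2.1 hPc.1.2.2.1
    fun t ht => exists_hausdorffDist_le_of_rBoundary h𝒯 (hX hT₀) (hX hT₁) hM hρ0 hρ hε0 hε1
      (by linarith) hskel hη hrη hr1 hb₀ hb₁ (hPc.1.1 ht)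
      (((subset_sUnion_of_mem ht).trans hPsupp).trans
        (closedBall_subset_closedBall (by linarith)))
  have hxPc : x +ᵥ P ∈ coverPatches T₁ (cball (R' - 1)) :=
    mem_coverPatches_of_subset (vadd_mem_coverPatches hPc (by linarith)) hxP
  have hxr := norm_mul_le_of_rBoundary h𝒯 (hX hT₀) (hX hT₁) hM hρ0 hρ (by linarith) hr1
    (by linarith) (by linarith) hb₀ (by linarith) hPc.1.1 hxPc
  have hxC : ‖x‖ ≤ C * r := by
    refine le_trans ?_ (mul_le_mul_of_nonneg_right hC2 hr.le)
    rw [div_mul_eq_mul_div, le_div_iff₀ hρ0]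
    linarith
  have hRC : 1 / (C * r) ≤ R' - 1 := by
    have h1 : 1 / (C * r) = R / C := by rw [hR]; field_simp
    have h2 : R / C ≤ R / 2 := div_le_div_of_nonneg_left hR0.le two_pos (by linarith)
    rw [h1]
    linarith
  exact ⟨by positivity, -x, by rwa [mem_closedBall, dist_zero_right, norm_neg],
    P, coverPatches_anti hPc (by linarith), x +ᵥ P, coverPatches_anti hxPc hRC, by
      rw [vadd_vadd, neg_add_cancel, zero_vadd]⟩

/-! ### Metric equivalence -/

theorem MetricEquivOn.of_le_mul {A : Type} {Y : Set A} {δ δ' : A → A → ℝ} {C C' : ℝ} (hC : 0 < C)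
    (hC' : 0 < C') (h : ∀ a ∈ Y, ∀ b ∈ Y, δ a b ≤ C * δ' a b)
    (h' : ∀ a ∈ Y, ∀ b ∈ Y, δ' a b ≤ C' * δ a b) : MetricEquivOn Y δ δ' :=
  ⟨C⁻¹, C', inv_pos.2 hC, hC', fun a ha b hb =>
    ⟨(inv_mul_le_iff₀ hC).2 (h a ha b hb), h' a ha b hb⟩⟩

theorem MetricEquivOn.symm {A : Type} {Y : Set A} {δ δ' : A → A → ℝ}
    (h : MetricEquivOn Y δ δ') : MetricEquivOn Y δ' δ := by
  obtain ⟨α, β, hα, hβ, h⟩ := h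
  exact of_le_mul hβ (inv_pos.2 hα) (fun a ha b hb => (h a ha b hb).2)
    fun a ha b hb => (le_inv_mul_iff₀ hα).2 (h a ha b hb).1

theorem MetricEquivOn.trans {A : Type} {Y : Set A} {δ₁ δ₂ δ₃ : A → A → ℝ}
    (h : MetricEquivOn Y δ₁ δ₂) (h' : MetricEquivOn Y δ₂ δ₃) : MetricEquivOn Y δ₁ δ₃ := by
  obtain ⟨α, β, hα, hβ, h⟩ := h
  obtain ⟨α', β', hα', hβ', h'⟩ := h'
  refine ⟨α' * α, β' * β, by positivity, by positivity, fun a ha b hb => ⟨?_, ?_⟩⟩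
  · rw [mul_assoc]
    exact (mul_le_mul_of_nonneg_left (h a ha b hb).1 hα'.le).trans (h' a ha b hb).1
  · rw [mul_assoc]
    exact (h' a ha b hb).2.trans (mul_le_mul_of_nonneg_left (h a ha b hb).2 hβ'.le)

end EuclTiling

theorem mainTheorem1 {d : ℕ} (hd : 0 < d)
    (𝒯 : Set (Set (Space d))) (h𝒯 : IsTileset 𝒯)
    (hconn : ∀ p ∈ 𝒯, IsConnected (interior p))
    (X : Set (Set (Set (Space d)))) (hX : X ⊆ fullShift 𝒯)
    (hinv : ∀ T ∈ X, ∀ x : Space d, x +ᵥ T ∈ X)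
    (hFLC : FLC X) :
    (MetricEquivOn X ds1 ds2 ∧ MetricEquivOn X ds1 dw1 ∧ MetricEquivOn X ds1 dw2 ∧
      MetricEquivOn X ds2 dw1 ∧ MetricEquivOn X ds2 dw2 ∧ MetricEquivOn X dw1 dw2) ∧
    ∃ c : ℝ, 0 < c ∧
      (∀ P₀ ∈ patchesOf X, ∀ P₁ ∈ patchesOf X, patchDist P₀ P₁ ≤ c →
        ∃ x : Space d, ‖x‖ = patchDist P₀ P₁ ∧ P₀ = x +ᵥ P₁) ∧
      ∀ T₀ ∈ X, ∀ T₁ ∈ X, ds1 T₀ T₁ ≤ (1 / c) * dw1 T₀ T₁ := by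
  obtain ⟨c, hc, hc1, hpatch⟩ := exists_patchDist_constant h𝒯 hconn hX hinv hFLC
  obtain ⟨C, hC, hsw⟩ := exists_ds1_le_mul_dw2 hd h𝒯 hconn hX hinv hFLC
  have h12 : MetricEquivOn X ds1 ds2 := .of_le_mul two_pos two_pos
    (fun a ha b hb => ds1_le_two_mul_ds2 h𝒯 hconn (hX ha) (hX hb))
    fun a ha b hb => ds2_le_two_mul_ds1 h𝒯 hconn (hX ha) (hX hb)
  have h13 : MetricEquivOn X ds1 dw1 := .of_le_mul (one_div_pos.2 hc) one_pos
    (fun a ha b hb => ds1_le_mul_dw1 hc hc1 hpatch ha hb) fun a _ b _ => dw1_le_ds1 a b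
  have h14 : MetricEquivOn X ds1 dw2 := .of_le_mul hC two_pos hsw
    fun a ha b hb => dw2_le_two_mul_ds1 h𝒯 (hX ha) (hX hb)
  exact ⟨⟨h12, h13, h14, h12.symm.trans h13, h12.symm.trans h14, h13.symm.trans h14⟩,
    c, hc, hpatch, fun a ha b hb => ds1_le_mul_dw1 hc hc1 hpatch ha hb⟩
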